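/- **Setting.** Let $d\ge 2$, let $\mathbb M=\mathbb R^{d}$ be Minkowski space with product $p\cdot x=p^0x^0-\sum_{i=1}^{d-1}p^ix^i$, let $\mathcal P_+^\uparrow=\{(a,\Lambda)\}$ be the proper orthochronous Poincaré group and $L_+^\uparrow$ the proper orthochronous Lorentz group. The space of inertial frames is $F=\mathbb M\times L_+^\uparrow$, with $(a,\Lambda)\cdot(x,\lambda)=(\Lambda x+a,\Lambda\lambda)$. Let $\mathcal H_S$, $\mathcal H_R$ be separable complex Hilbert spaces. $\mathcal H_S$ carries a continuous unitary representation $U$ of $\mathcal P_+^\uparrow$; phases are allowed in $U(g)U(h)=c\,U(gh)$, but $c=1$ whenever $g$ or $h$ is a translation, and then continuity is required of $g\mapsto U(g)AU(g)^\dagger$ (weakly, for every bounded $A$) and of $a\mapsto U(a,1)$. Write $U(a,1)=e^{iP\cdot a}$, and let $\sigma(P)\subset\mathbb R^d$ be the joint spectrum of the generators $P_\mu$. A relativistic quantum reference frame $\mathcal R$ is a continuous projective unitary representation of $\mathcal P_+^\uparrow$ on $\mathcal H_R$ with a covariant positive operator-valued measure $\mathsf E$ on $F$ with values in the effects $0\le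 \mathsf E(X)\le 1$. For a density operator $\omega$ on $\mathcal H_R$ let $\mu_\omega(X)=\operatorname{Tr}[\omega\,\mathsf E(X)]$, with conditional measures $\nu_\omega(\cdot\mid x)$ on $L_+^\uparrow$ given $x\in\mathbb M$. $(\mathcal R,\omega)$ is globally oriented if $\nu_\omega(\cdot\mid x)=\nu_\omega(\cdot\mid x')$ for almost all $x,x'$ with respect to the marginal of $\mu_\omega$ on $\mathbb M$. In that case $\nu_\omega$ denotes the version that does not depend on $x$, the (normalised) marginal of $\mu_\omega$ on $L_+^\uparrow$ (the zero measure if $\mu_\omega=0$), and for $\phi\in\mathcal B(\mathcal H_S)$ and every $x\in\mathbb M$ put $$\hat\phi_\omega(x)=\int_{L_+^\uparrow}U(x,\lambda)\,\phi\,U(x,\lambda)^\dagger\,d\nu_\omega(\lambda)\qquad\text{(weak integral)}.$$ Let $\Omega$ be a $\mathcal P_+^\uparrow$-invariant density operator on $\mathcal H_S$, let $n\ge1$, let $\omega_1,\dots,\omega_n$ be density operators on $\mathcal H_R$ such that every $(\mathcal R,\omega_i)$ is globally oriented, and let $\phi_1,\dots,\phi_n\in\mathcal B(\mathcal H_S)$.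 Define $$W_n(x_1,\dots,x_n)=\operatorname{Tr}\big[\Omega\,\hat\phi_{1,\omega_1}(x_1)\cdots\hat\phi_{n,\omega_n}(x_n)\big],$$ $$\mathbf W_n(\xi_1,\dots,\xi_{n-1})=\operatorname{Tr}\Big[\Omega\,U\Big(\sum_{i=1}^{n-1}\xi_i,1\Big)\hat\phi_{1,\omega_1}(0)\prod_{j=2}^{n}\big(U(\xi_{j-1},1)^\dagger\,\hat\phi_{j,\omega_j}(0)\big)\Big].$$ **Proposition.** The Fourier transforms $$\tilde W_n(p_1,\dots,p_n)=\int e^{i\sum_i p_i\cdot x_i}\,W_n(x)\,dx,\qquad \tilde{\mathbf W}_n(q_1,\dots,q_{n-1})=\int e^{i\sum_j q_j\cdot\xi_j}\,\mathbf W_n(\xi)\,d\xi$$ exist as tempered distributions and satisfy $$\tilde W_n(p_1,\dots,p_n)=(2\pi)^d\,\delta\Big(\sum_{i=1}^np_i\Big)\,\tilde{\mathbf W}_n(p_1,\,p_1+p_2,\,\dots,\,p_1+\cdots+p_{n-1}).$$ If moreover the spectrum condition $\sigma(P)\subset\{p\mid p^0\ge0,\ p\cdot p\ge0\}$ holds,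 then $\tilde{\mathbf W}_n$ vanishes on the open set of all $(q_1,\dots,q_{n-1})$ with $q_j\notin\sigma(P)$ for at least one $j$. -/

import Mathlib

open MeasureTheory ProbabilityTheory Matrix
open scoped InnerProductSpace SchwartzMap ENNReal

noncomputable section

namespace RQFT

/-! ### Minkowski space and the proper orthochronous Poincare group

`s` is the number of space dimensions, so the spacetime dimension is `d = s + 1`. -/

/-- Minkowski space `ℝ^{1+s}`; coordinate `0` is time. -/
abbrev Mink (s : ℕ) : Type := EuclideanSpace ℝ (Fin (s + 1))

/-- The Minkowski metric, in mostly-minus signature, as a matrix. -/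
def eta (s : ℕ) : Matrix (Fin (s + 1)) (Fin (s + 1)) ℝ :=
  Matrix.diagonal (Fin.cons 1 fun _ => -1)

/-- The Minkowski product `p · x = p⁰ x⁰ - ∑ pⁱ xⁱ`. -/
def mdot {s : ℕ} (p x : Mink s) : ℝ :=
  p 0 * x 0 - ∑ i : Fin s, p i.succ * x i.succ

/-- The closed forward cone `{p | p⁰ ≥ 0, p² ≥ 0}`. -/
def forwardCone (s : ℕ) : Set (Mink s) := {p | 0 ≤ p 0 ∧ 0 ≤ mdot p p}

lemma eta_sq (s : ℕ) : eta s * eta s = 1 := by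
  rw [eta, Matrix.diagonal_mul_diagonal, ← Matrix.diagonal_one]
  congr 1
  funext i
  refine Fin.cases ?_ (fun j => ?_) i <;> simp

/-- The other form of the Lorentz condition. -/
lemma lorentz_transpose {s : ℕ} {A : Matrix (Fin (s + 1)) (Fin (s + 1)) ℝ}
    (h : Aᵀ * eta s * A = eta s) : A * eta s * Aᵀ = eta s := by
  have h1 : (eta s * Aᵀ * eta s) * A = 1 := by
    rw [Matrix.mul_assoc, Matrix.mul_assoc, ← Matrix.mul_assoc Aᵀ, h, eta_sq]
  have h2 : A * (eta s * Aᵀ * eta s) = 1 := mul_eq_one_comm.mp h1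
  calc A * eta s * Aᵀ = A * (eta s * Aᵀ * eta s) * eta s := by
        simp only [Matrix.mul_assoc, eta_sq, Matrix.mul_one]
    _ = eta s := by rw [h2, Matrix.one_mul]

lemma lorentz_col {s : ℕ} {A : Matrix (Fin (s + 1)) (Fin (s + 1)) ℝ}
    (h : Aᵀ * eta s * A = eta s) : A 0 0 ^ 2 = 1 + ∑ i : Fin s, A i.succ 0 ^ 2 := by
  have h0 := congrFun (congrFun h 0) 0
  rw [Matrix.mul_apply] at h0
  simp only [eta, Matrix.mul_diagonal, Matrix.transpose_apply, Fin.sum_univ_succ, Fin.cons_zero,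
    Fin.cons_succ, Matrix.diagonal_apply_eq] at h0
  have h2 : ∑ i : Fin s, A i.succ 0 * -1 * A i.succ 0 = - ∑ i : Fin s, A i.succ 0 ^ 2 := by
    rw [← Finset.sum_neg_distrib]; exact Finset.sum_congr rfl fun i _ => by ring
  rw [h2] at h0
  linarith [h0, sq (A 0 0)]

lemma lorentz_row {s : ℕ} {A : Matrix (Fin (s + 1)) (Fin (s + 1)) ℝ}
    (h : Aᵀ * eta s * A = eta s) : A 0 0 ^ 2 = 1 + ∑ i : Fin s, A 0 i.succ ^ 2 := by
  have h' : (Aᵀ)ᵀ * eta s * Aᵀ = eta s := by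
    rw [Matrix.transpose_transpose]; exact lorentz_transpose h
  simpa using lorentz_col h'

/-- The proper orthochronous Lorentz group `SO(1, s)↑`: the matrices of determinant one that
preserve the Minkowski metric and the direction of time. -/
def Lorentz (s : ℕ) : Subgroup (SpecialLinearGroup (Fin (s + 1)) ℝ) where
  carrier := {A | A.1ᵀ * eta s * A.1 = eta s ∧ 1 ≤ A.1 0 0}
  one_mem' := by
    change (1 : Matrix (Fin (s + 1)) (Fin (s + 1)) ℝ)ᵀ * eta s * 1 = eta s ∧
      1 ≤ (1 : Matrix (Fin (s + 1)) (Fin (s + 1)) ℝ) 0 0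
    simp
  mul_mem' := by
    rintro ⟨a, da⟩ ⟨b, db⟩ ⟨hA, hA0⟩ ⟨hB, hB0⟩
    change aᵀ * eta s * a = eta s at hA
    change bᵀ * eta s * b = eta s at hB
    change 1 ≤ a 0 0 at hA0
    change 1 ≤ b 0 0 at hB0
    change (a * b)ᵀ * eta s * (a * b) = eta s ∧ 1 ≤ (a * b) 0 0
    have hAB : (a * b)ᵀ * eta s * (a * b) = eta s := by
      rw [Matrix.transpose_mul]
      calc _ = bᵀ * (aᵀ * eta s * a) * b := by simp only [Matrix.mul_assoc]
        _ = eta s := by rw [hA, hB]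
    refine ⟨hAB, ?_⟩
    have key := lorentz_col hAB
    have hsq : 1 ≤ (a * b) 0 0 ^ 2 := by
      rw [key]
      exact le_add_of_nonneg_right (Finset.sum_nonneg fun i _ => sq_nonneg _)
    have hpos : 0 < (a * b) 0 0 := by
      have ra := lorentz_row hA
      have cb := lorentz_col hB
      have cs := Finset.sum_mul_sq_le_sq_mul_sq Finset.univ
        (fun i : Fin s => a 0 i.succ) (fun i : Fin s => b i.succ 0)
      rw [Matrix.mul_apply, Fin.sum_univ_succ]
      have h1 : ∑ i : Fin s, a 0 i.succ ^ 2 = a 0 0 ^ 2 - 1 := by linarith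
      have h2 : ∑ i : Fin s, b i.succ 0 ^ 2 = b 0 0 ^ 2 - 1 := by linarith
      rw [h1, h2] at cs
      have hab : 0 < a 0 0 * b 0 0 := by positivity
      have hlt : (∑ i : Fin s, a 0 i.succ * b i.succ 0) ^ 2 < (a 0 0 * b 0 0) ^ 2 := by
        nlinarith
      linarith [(abs_lt_of_sq_lt_sq' hlt hab.le).1]
    nlinarith
  inv_mem' := by
    rintro ⟨a, da⟩ ⟨hA, hA0⟩
    change aᵀ * eta s * a = eta s at hA
    change 1 ≤ a 0 0 at hA0
    change (adjugate a)ᵀ * eta s * adjugate a = eta s ∧ 1 ≤ adjugate a 0 0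
    have h1 : (eta s * aᵀ * eta s) * a = 1 := by
      rw [Matrix.mul_assoc, Matrix.mul_assoc, ← Matrix.mul_assoc aᵀ, hA, eta_sq]
    have h2 : a * adjugate a = 1 := by rw [Matrix.mul_adjugate, da, one_smul]
    have h3 : adjugate a = eta s * aᵀ * eta s := (left_inv_eq_right_inv h1 h2).symm
    rw [h3]
    constructor
    · have h4 := lorentz_transpose hA
      have e : (eta s)ᵀ = eta s := by rw [eta, Matrix.diagonal_transpose]
      simp only [Matrix.transpose_mul, Matrix.transpose_transpose, e]
      calc _ = eta s * (a * (eta s * (eta s * eta s)) * aᵀ) * eta s := by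
            simp only [Matrix.mul_assoc]
        _ = eta s := by
          rw [eta_sq, Matrix.mul_one, h4, eta_sq, Matrix.one_mul]
    · simp only [eta, Matrix.mul_diagonal, Matrix.diagonal_mul, Matrix.transpose_apply,
        Fin.cons_zero, one_mul, mul_one]
      exact hA0

instance (s : ℕ) : MeasurableSpace (Lorentz s) := borel _

instance (s : ℕ) : BorelSpace (Lorentz s) := ⟨rfl⟩

instance (s : ℕ) : PolishSpace (Lorentz s) := by
  have hc : IsClosed {A : SpecialLinearGroup (Fin (s + 1)) ℝ |
      A.1ᵀ * eta s * A.1 = eta s ∧ 1 ≤ A.1 0 0} := by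
    have hv : Continuous fun A : SpecialLinearGroup (Fin (s + 1)) ℝ => A.1 :=
      continuous_subtype_val
    refine IsClosed.inter ?_ ?_
    · exact isClosed_eq (((hv.matrix_transpose).matrix_mul continuous_const).matrix_mul hv)
        continuous_const
    · exact isClosed_le continuous_const (hv.matrix_elem 0 0)
  have h1 : Topology.IsClosedEmbedding (fun A : Lorentz s => A.1.1) :=
    Matrix.SpecialLinearGroup.isClosedEmbedding_val.comp hc.isClosedEmbedding_subtypeVal
  have : PolishSpace (Matrix (Fin (s + 1)) (Fin (s + 1)) ℝ) :=
    inferInstanceAs (PolishSpace (Fin (s + 1) → Fin (s + 1) → ℝ))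
  exact h1.polishSpace

/-- The action of a Lorentz transformation on a vector. -/
def lorentzAct {s : ℕ} (L : Lorentz s) (x : Mink s) : Mink s :=
  WithLp.toLp 2 (L.1.1 *ᵥ x.ofLp)

/-- The Poincare transformations `(a, Λ)`, `x ↦ Λ x + a`. After the choice of a reference frame
the same type is the space `F` of inertial frames `(x, λ)`, on which the group acts on the
left. It carries the product topology and the Borel σ-algebra. -/
abbrev Poincare (s : ℕ) : Type := Mink s × Lorentz s

/-- `(a, Λ) (b, Λ') = (Λ b + a, Λ Λ')`: the group law of the Poincare group, and its action on
the space of frames. -/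
def Poincare.comp {s : ℕ} (g h : Poincare s) : Poincare s :=
  (lorentzAct g.2 h.1 + g.1, g.2 * h.2)

/-- The pure translation by `a`. -/
def transl {s : ℕ} (a : Mink s) : Poincare s := (a, 1)

/-! ### Traces and density operators -/

section Trace

variable {H : Type*} [NormedAddCommGroup H] [InnerProductSpace ℂ H] [CompleteSpace H]

variable (H) in
/-- The index set of a Hilbert basis of `H`. -/
def basisIndex : Set H := (exists_hilbertBasis ℂ H).choose

variable (H) in
/-- A Hilbert basis of `H`. -/
def basis : HilbertBasis (basisIndex H) ℂ H := (exists_hilbertBasis ℂ H).choose_spec.choose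

/-- The trace `∑ ⟨e, T e⟩` over a Hilbert basis. For trace-class `T` (in particular for `T = ρ A`
with `ρ` a density operator) the sum converges absolutely and does not depend on the basis. -/
def trace (T : H →L[ℂ] H) : ℂ := ∑' i, ⟪basis H i, T (basis H i)⟫_ℂ

/-- Density operators: positive trace-class operators of trace one. -/
structure IsDensity (ρ : H →L[ℂ] H) : Prop where
  pos : ρ.IsPositive
  hasSum : HasSum (fun i => ⟪basis H i, ρ (basis H i)⟫_ℂ) 1

lemma basis_sq {ι : Type*} (b : HilbertBasis ι ℂ H) (x : H) :
    HasSum (fun i => ‖⟪b i, x⟫_ℂ‖ ^ 2) (‖x‖ ^ 2) := by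
  have h := Complex.reCLM.hasSum (b.hasSum_inner_mul_inner x x)
  have e : Complex.reCLM ⟪x, x⟫_ℂ = ‖x‖ ^ 2 := by
    rw [inner_self_eq_norm_sq_to_K]; norm_cast
  rw [e] at h
  convert h using 2 with i
  change _ = (⟪x, b i⟫_ℂ * ⟪b i, x⟫_ℂ).re
  rw [← inner_conj_symm x, Complex.conj_mul']
  norm_cast

lemma summable_basis_sq {ι : Type*} (b : HilbertBasis ι ℂ H) (v : ι → H)
    (hv : Summable fun i => ‖v i‖ ^ 2) : Summable fun p : ι × ι => ‖⟪b p.2, v p.1⟫_ℂ‖ ^ 2 := by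
  have h0 : 0 ≤ fun p : ι × ι => ‖⟪b p.2, v p.1⟫_ℂ‖ ^ 2 := fun p => sq_nonneg _
  rw [summable_prod_of_nonneg h0]
  refine ⟨fun i => (basis_sq b (v i)).summable, ?_⟩
  have e : (fun i => ∑' j, ‖⟪b j, v i⟫_ℂ‖ ^ 2) = fun i => ‖v i‖ ^ 2 :=
    funext fun i => (basis_sq b (v i)).tsum_eq
  exact e ▸ hv

lemma sqrt_spec {ρ : H →L[ℂ] H} (hρ : ρ.IsPositive) :
    CFC.sqrt ρ * CFC.sqrt ρ = ρ ∧ ∀ x y, ⟪CFC.sqrt ρ x, y⟫_ℂ = ⟪x, CFC.sqrt ρ y⟫_ℂ := by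
  have h0 : 0 ≤ ρ := (ContinuousLinearMap.nonneg_iff_isPositive ρ).2 hρ
  refine ⟨CFC.sqrt_mul_sqrt_self ρ h0, fun x y => ?_⟩
  have h1 : (CFC.sqrt ρ).IsPositive :=
    (ContinuousLinearMap.nonneg_iff_isPositive _).1 (CFC.sqrt_nonneg ρ)
  exact h1.isSymmetric x y

lemma hasSum_sqrt_aux {ι : Type*} (b : HilbertBasis ι ℂ H) {ρ S : H →L[ℂ] H}
    (hS : S * S = ρ) (hsym : ∀ x y, ⟪S x, y⟫_ℂ = ⟪x, S y⟫_ℂ)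
    (hsum : Summable fun i => ⟪b i, ρ (b i)⟫_ℂ) (B : H →L[ℂ] H) :
    HasSum (fun i => ⟪S (b i), B (S (b i))⟫_ℂ) (∑' i, ⟪b i, (ρ * B) (b i)⟫_ℂ) := by
  have hρS : ∀ x, ρ x = S (S x) := fun x => by
    rw [← hS]
    rfl
  have hHS : Summable fun i => ‖S (b i)‖ ^ 2 := by
    have h := (Complex.reCLM.hasSum hsum.hasSum).summable
    convert h using 2 with i
    change _ = (⟪b i, ρ (b i)⟫_ℂ).re
    rw [hρS, ← hsym, inner_self_eq_norm_sq_to_K]; norm_cast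
  have hF1 : Summable fun p : ι × ι => ‖⟪b p.2, S (b p.1)⟫_ℂ‖ ^ 2 := by
    exact summable_basis_sq b (fun i => S (b i)) hHS
  have hF2' : Summable fun p : ι × ι =>
      ‖⟪b p.2, (ContinuousLinearMap.adjoint B) (S (b p.1))⟫_ℂ‖ ^ 2 := by
    have h1 : Summable fun i => ‖ContinuousLinearMap.adjoint B (S (b i))‖ ^ 2 := by
      refine Summable.of_nonneg_of_le (fun i => sq_nonneg _) (fun i => ?_)
        (hHS.mul_left (‖ContinuousLinearMap.adjoint B‖ ^ 2))
      rw [← mul_pow]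
      exact pow_le_pow_left₀ (norm_nonneg _) (ContinuousLinearMap.le_opNorm _ _) 2
    exact summable_basis_sq b (fun i => ContinuousLinearMap.adjoint B (S (b i))) h1
  have hF2 : Summable fun p : ι × ι => ‖⟪b p.2, S (B (b p.1))⟫_ℂ‖ ^ 2 := by
    refine ((Equiv.prodComm ι ι).summable_iff.2 hF2').congr fun p => ?_
    change ‖⟪b p.1, (ContinuousLinearMap.adjoint B) (S (b p.2))⟫_ℂ‖ ^ 2 = _
    rw [← hsym, norm_inner_symm, ContinuousLinearMap.adjoint_inner_left]
  have hFs : Summable fun p : ι × ι => ⟪S (b p.1), b p.2⟫_ℂ * ⟪b p.2, S (B (b p.1))⟫_ℂ := by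
    refine Summable.of_norm_bounded (hF1.add hF2) fun p => ?_
    rw [norm_mul, norm_inner_symm]
    nlinarith [sq_nonneg (‖⟪b p.2, S (b p.1)⟫_ℂ‖ - ‖⟪b p.2, S (B (b p.1))⟫_ℂ‖),
      sq_nonneg ‖⟪b p.2, S (b p.1)⟫_ℂ‖, sq_nonneg ‖⟪b p.2, S (B (b p.1))⟫_ℂ‖]
  have hrow : ∀ i, HasSum (fun j => ⟪S (b i), b j⟫_ℂ * ⟪b j, S (B (b i))⟫_ℂ)
      ⟪b i, (ρ * B) (b i)⟫_ℂ := fun i => by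
    have h := b.hasSum_inner_mul_inner (S (b i)) (S (B (b i)))
    rwa [hsym (b i) (S (B (b i))), ← hρS] at h
  have hcol : ∀ j, HasSum (fun i => ⟪S (b i), b j⟫_ℂ * ⟪b j, S (B (b i))⟫_ℂ)
      ⟪S (b j), B (S (b j))⟫_ℂ := fun j => by
    have h := b.hasSum_inner_mul_inner (ContinuousLinearMap.adjoint B (S (b j))) (S (b j))
    rw [ContinuousLinearMap.adjoint_inner_left] at h
    have e : (fun i => ⟪S (b i), b j⟫_ℂ * ⟪b j, S (B (b i))⟫_ℂ) =
        fun i => ⟪ContinuousLinearMap.adjoint B (S (b j)), b i⟫_ℂ * ⟪b i, S (b j)⟫_ℂ := by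
      funext i
      rw [ContinuousLinearMap.adjoint_inner_left, hsym (b i), hsym (b j), mul_comm]
    rw [e]
    exact h
  have h1 := hFs.hasSum.prod_fiberwise hrow
  have h2 := ((Equiv.prodComm ι ι).hasSum_iff.2 hFs.hasSum).prod_fiberwise hcol
  rw [h1.tsum_eq]
  exact h2

/-- `Tr[ρ B] = ∑ ⟨√ρ e, B √ρ e⟩`, with a convergent sum. -/
lemma IsDensity.hasSum_sqrt {ρ : H →L[ℂ] H} (hρ : IsDensity ρ) (B : H →L[ℂ] H) :
    HasSum (fun i => ⟪CFC.sqrt ρ (basis H i), B (CFC.sqrt ρ (basis H i))⟫_ℂ) (trace (ρ * B)) :=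
  hasSum_sqrt_aux (basis H) (sqrt_spec hρ.pos).1 (sqrt_spec hρ.pos).2 hρ.hasSum.summable B

end Trace

/-- The state space `𝒟(H)`. -/
abbrev State (H : Type*) [NormedAddCommGroup H] [InnerProductSpace ℂ H] [CompleteSpace H] :
    Type _ := {ρ : H →L[ℂ] H // IsDensity ρ}

/-! ### Integrals of operator-valued functions -/

section WeakIntegral

variable {α : Type*} [MeasurableSpace α]
variable {H : Type*} [NormedAddCommGroup H] [InnerProductSpace ℂ H] [CompleteSpace H]

/-- `A` is the weak integral `∫ f dμ`: all matrix elements of `f` are integrable, and integrate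
to those of `A`. -/
def IsWeakIntegral (μ : Measure α) (f : α → H →L[ℂ] H) (A : H →L[ℂ] H) : Prop :=
  ∀ ξ η : H, Integrable (fun a => ⟪ξ, f a η⟫_ℂ) μ ∧ ⟪ξ, A η⟫_ℂ = ∫ a, ⟪ξ, f a η⟫_ℂ ∂μ

lemma IsWeakIntegral.unique {μ : Measure α} {f : α → H →L[ℂ] H} {A B : H →L[ℂ] H}
    (hA : IsWeakIntegral μ f A) (hB : IsWeakIntegral μ f B) : A = B := by
  ext η
  exact ext_inner_left ℂ fun ξ => by rw [(hA ξ η).2, (hB ξ η).2]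

/-- Bounded weakly measurable functions have a weak integral over a finite measure. -/
lemma exists_isWeakIntegral (μ : Measure α) [IsFiniteMeasure μ] (f : α → H →L[ℂ] H)
    (hm : ∀ ξ η, AEStronglyMeasurable (fun a => ⟪ξ, f a η⟫_ℂ) μ) (C : ℝ)
    (hC : ∀ a, ‖f a‖ ≤ C) : ∃ A, IsWeakIntegral μ f A := by
  have hb : ∀ ξ η a, ‖⟪ξ, f a η⟫_ℂ‖ ≤ C * ‖ξ‖ * ‖η‖ := fun ξ η a => by
    calc ‖⟪ξ, f a η⟫_ℂ‖ ≤ ‖ξ‖ * ‖f a η‖ := norm_inner_le_norm _ _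
      _ ≤ ‖ξ‖ * (C * ‖η‖) := by
        gcongr
        exact (f a).le_of_opNorm_le (hC a) η
      _ = C * ‖ξ‖ * ‖η‖ := by ring
  have hi : ∀ ξ η, Integrable (fun a => ⟪ξ, f a η⟫_ℂ) μ := fun ξ η =>
    (integrable_const (C * ‖ξ‖ * ‖η‖)).mono' (hm ξ η) (Filter.Eventually.of_forall (hb ξ η))
  let B₀ : H →ₗ⋆[ℂ] H →ₗ[ℂ] ℂ := LinearMap.mk₂'ₛₗ (starRingEnd ℂ) (RingHom.id ℂ)
    (fun ξ η => ∫ a, ⟪ξ, f a η⟫_ℂ ∂μ)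
    (fun x y z => by simp only [inner_add_left]; exact integral_add (hi _ _) (hi _ _))
    (fun c x y => by simp only [inner_smul_left]; exact integral_const_mul _ _)
    (fun x y z => by
      simp only [map_add, inner_add_right]; exact integral_add (hi _ _) (hi _ _))
    (fun c x y => by
      simp only [map_smul, inner_smul_right]; exact integral_const_mul _ _)
  let B : H →L⋆[ℂ] H →L[ℂ] ℂ := B₀.mkContinuous₂ (C * μ.real Set.univ) fun x y => by
    change ‖∫ a, ⟪x, f a y⟫_ℂ ∂μ‖ ≤ _
    calc _ ≤ C * ‖x‖ * ‖y‖ * μ.real Set.univ :=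
          norm_integral_le_of_norm_le_const (Filter.Eventually.of_forall (hb x y))
      _ = _ := by ring
  refine ⟨ContinuousLinearMap.adjoint (InnerProductSpace.continuousLinearMapOfBilin B),
    fun ξ η => ⟨hi ξ η, ?_⟩⟩
  rw [ContinuousLinearMap.adjoint_inner_right,
    InnerProductSpace.continuousLinearMapOfBilin_apply]
  rfl

open Classical in
/-- The weak integral `∫ f dμ` of an operator-valued function (`0` if there is none). -/
def weakIntegral (μ : Measure α) (f : α → H →L[ℂ] H) : H →L[ℂ] H :=
  if h : ∃ A, IsWeakIntegral μ f A then h.choose else 0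

lemma IsWeakIntegral.eq {μ : Measure α} {f : α → H →L[ℂ] H} {A : H →L[ℂ] H}
    (hA : IsWeakIntegral μ f A) : weakIntegral μ f = A := by
  have h : ∃ A, IsWeakIntegral μ f A := ⟨A, hA⟩
  rw [weakIntegral, dif_pos h]
  exact h.choose_spec.unique hA

end WeakIntegral

/-! ### Representations of the Poincare group -/

section Representations

variable {s : ℕ} {H : Type*} [NormedAddCommGroup H] [InnerProductSpace ℂ H] [CompleteSpace H]

variable (s H) in
/-- Ultraweakly continuous projective unitary representations of the Poincare group. As phases
are not observable, continuity is asked of the induced action on bounded operators. -/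
structure ProjectiveRep where
  U : Poincare s → unitary (H →L[ℂ] H)
  map_comp : ∀ g h, ∃ c : ℂ, ‖c‖ = 1 ∧
    (U g : H →L[ℂ] H) * (U h : H →L[ℂ] H) = c • (U (g.comp h) : H →L[ℂ] H)
  continuous_conj : ∀ (A : H →L[ℂ] H) (ξ η : H), Continuous fun g =>
    ⟪ξ, ((U g : H →L[ℂ] H) * A * star (U g : H →L[ℂ] H)) η⟫_ℂ

/-- The left action `g · A = U(g) A U(g)†` on bounded operators. -/
def ProjectiveRep.act (V : ProjectiveRep s H) (g : Poincare s) (A : H →L[ℂ] H) : H →L[ℂ] H :=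
  (V.U g : H →L[ℂ] H) * A * star (V.U g : H →L[ℂ] H)

variable (s H) in
/-- The representations carried by the system. No phases occur in products in which one factor is
a translation, so that the translations are represented by a continuous unitary group with a
Lorentz-covariant energy-momentum; phases may remain for Lorentz transformations. All continuous
unitary representations of the Poincare group are of this form. -/
structure SystemRep extends ProjectiveRep s H where
  transl_comp : ∀ a g, U (transl a) * U g = U ((transl a).comp g)
  comp_transl : ∀ g a, U g * U (transl a) = U (g.comp (transl a))
  continuous_transl : ∀ ξ η : H, Continuous fun a : Mink s =>
    ⟪ξ, (U (transl a) : H →L[ℂ] H) η⟫_ℂ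

namespace SystemRep

/-- The unitary `U(a, 1)` that represents the translation by `a`. -/
def T (V : SystemRep s H) (a : Mink s) : H →L[ℂ] H := (V.U (transl a) : H →L[ℂ] H)

/-- Poincare invariant states: `U(g)† Ω U(g) = Ω` for all `g`. -/
def IsInvariant (V : SystemRep s H) (Ω : State H) : Prop :=
  ∀ g, star (V.U g : H →L[ℂ] H) * Ω.1 * (V.U g : H →L[ℂ] H) = Ω.1

/-- `ξ` lies in the domain of all generators `P_μ` of translations, and `P_μ ξ = Pξ μ`. The
generators are fixed by `U(a, 1) = exp(i P · a)`, that is, `i P_μ ξ` is the derivative of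
`t ↦ U(t e_μ, 1) ξ` at `0`. -/
def HasMomentum (V : SystemRep s H) (ξ : H) (Pξ : Fin (s + 1) → H) : Prop :=
  ∀ μ, HasDerivAt (fun t : ℝ => V.T (t • EuclideanSpace.single μ (1 : ℝ)) ξ)
    (Complex.I • Pξ μ) 0

/-- The joint spectrum `σ(P)` of the (commuting, self-adjoint) generators of translations: `p`
belongs to it if and only if there are unit vectors `ξ` in the common domain with `‖(P_μ - p_μ) ξ‖`
arbitrarily small for all `μ` at once. Here `p_μ = p · e_μ` is the lower-index component. -/
def jointSpectrum (V : SystemRep s H) : Set (Mink s) :=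
  {p | ∀ ε > 0, ∃ (ξ : H) (Pξ : Fin (s + 1) → H), ‖ξ‖ = 1 ∧ V.HasMomentum ξ Pξ ∧
    ∀ μ, ‖Pξ μ - ((mdot p (EuclideanSpace.single μ 1) : ℝ) : ℂ) • ξ‖ < ε}

/-- The spectrum condition: the energy-momentum spectrum lies in the closed forward cone. -/
def SpectrumCondition (V : SystemRep s H) : Prop := V.jointSpectrum ⊆ forwardCone s

end SystemRep

end Representations

/-! ### Relativistic quantum reference frames -/

variable (s : ℕ) (H : Type*) [NormedAddCommGroup H] [InnerProductSpace ℂ H] [CompleteSpace H] in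
/-- A relativistic quantum reference frame: a projective representation of the Poincare group
with a covariant positive operator-valued measure on the space of inertial frames. -/
structure RelativisticQRF extends ProjectiveRep s H where
  /-- the frame observable -/
  E : Set (Poincare s) → H →L[ℂ] H
  nonneg : ∀ W, MeasurableSet W → 0 ≤ E W
  le_one : ∀ W, MeasurableSet W → E W ≤ 1
  /-- countable additivity, weakly (equivalently, as the values are effects, ultraweakly) -/
  additive : ∀ W : ℕ → Set (Poincare s), (∀ n, MeasurableSet (W n)) →
    Pairwise (Function.onFun Disjoint W) →
    ∀ ξ η, HasSum (fun n => ⟪ξ, E (W n) η⟫_ℂ) ⟪ξ, E (⋃ n, W n) η⟫_ℂ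
  covariant : ∀ g W, MeasurableSet W → toProjectiveRep.act g (E W) = E (g.comp '' W)

namespace RelativisticQRF

variable {s : ℕ} {H : Type*} [NormedAddCommGroup H] [InnerProductSpace ℂ H] [CompleteSpace H]

lemma E_term_nonneg (R : RelativisticQRF s H) {W : Set (Poincare s)} (hW : MeasurableSet W)
    (ξ : H) : 0 ≤ (⟪ξ, R.E W ξ⟫_ℂ).re := by
  have h := (ContinuousLinearMap.nonneg_iff_isPositive _).1 (R.nonneg W hW)
  have h2 := h.inner_nonneg_right ξ
  exact (Complex.le_def.1 h2).1

lemma ofReal_trace (R : RelativisticQRF s H) (ρ : State H) {W : Set (Poincare s)}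
    (hW : MeasurableSet W) : ENNReal.ofReal (trace (ρ.1 * R.E W)).re =
      ∑' i, ENNReal.ofReal
        (⟪CFC.sqrt ρ.1 (basis H i), R.E W (CFC.sqrt ρ.1 (basis H i))⟫_ℂ).re := by
  have h := Complex.reCLM.hasSum (ρ.2.hasSum_sqrt (R.E W))
  have h2 : HasSum (fun i =>
      (⟪CFC.sqrt ρ.1 (basis H i), R.E W (CFC.sqrt ρ.1 (basis H i))⟫_ℂ).re)
      (trace (ρ.1 * R.E W)).re := h
  rw [← h2.tsum_eq]
  exact ENNReal.ofReal_tsum_of_nonneg (fun i => R.E_term_nonneg hW _) h2.summable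

lemma E_empty (R : RelativisticQRF s H) : R.E ∅ = 0 := by
  ext η
  refine ext_inner_left ℂ fun ξ => ?_
  have h := (R.additive (fun _ => ∅) (fun _ => MeasurableSet.empty)
    (fun _ _ _ => disjoint_bot_left) ξ η).summable
  rw [summable_const_iff] at h
  simpa using h

/-- The Born measure `W ↦ Tr[ω E(W)]` on the space of frames. -/
def born (R : RelativisticQRF s H) (ω : State H) : Measure (Poincare s) :=
  Measure.ofMeasurable (fun W _ => ENNReal.ofReal (trace (ω.1 * R.E W)).re)
    (by simp [R.E_empty, trace])
    (by
      intro W hW hd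
      rw [R.ofReal_trace ω (MeasurableSet.iUnion hW)]
      simp_rw [fun n => R.ofReal_trace ω (hW n)]
      rw [ENNReal.tsum_comm]
      congr 1
      funext i
      have h := Complex.reCLM.hasSum (R.additive W hW hd (CFC.sqrt ω.1 (basis H i))
        (CFC.sqrt ω.1 (basis H i)))
      have h2 : HasSum (fun n =>
          (⟪CFC.sqrt ω.1 (basis H i), R.E (W n) (CFC.sqrt ω.1 (basis H i))⟫_ℂ).re)
          (⟪CFC.sqrt ω.1 (basis H i), R.E (⋃ n, W n) (CFC.sqrt ω.1 (basis H i))⟫_ℂ).re := h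
      rw [← h2.tsum_eq]
      exact ENNReal.ofReal_tsum_of_nonneg (fun n => R.E_term_nonneg (hW n) _) h2.summable)

lemma born_apply (R : RelativisticQRF s H) (ω : State H) {W : Set (Poincare s)}
    (hW : MeasurableSet W) : R.born ω W = ENNReal.ofReal (trace (ω.1 * R.E W)).re :=
  Measure.ofMeasurable_apply W hW

instance (R : RelativisticQRF s H) (ω : State H) : IsFiniteMeasure (R.born ω) :=
  ⟨by rw [R.born_apply ω MeasurableSet.univ]; exact ENNReal.ofReal_lt_top⟩

/-- `(R, ω)` is globally oriented: the conditional measures `ν(· | x)` of the Born measure on the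
Lorentz fibre agree for almost all `x`, `x'`, with respect to the spacetime marginal. -/
def GloballyOriented (R : RelativisticQRF s H) (ω : State H) : Prop :=
  ∀ᵐ x ∂(R.born ω).fst, ∀ᵐ x' ∂(R.born ω).fst,
    (R.born ω).condKernel x = (R.born ω).condKernel x'

open Classical in
/-- The conditional measure `ν(· | x)` on the Lorentz fibre. It is only determined for almost all
`x`. For globally oriented frames we take the version that is constant in `x`, namely the
(normalised) Lorentz marginal; in general we extend by zero outside of the support of the
spacetime marginal. -/
def lorentzCond (R : RelativisticQRF s H) (ω : State H) (x : Mink s) : Measure (Lorentz s) :=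
  if R.GloballyOriented ω then ((R.born ω) Set.univ)⁻¹ • (R.born ω).snd
  else if x ∈ (R.born ω).fst.support then (R.born ω).condKernel x else 0

/-- `lorentzCond` is a version of the conditional measure. -/
lemma lorentzCond_ae (R : RelativisticQRF s H) (ω : State H) :
    ∀ᵐ x ∂(R.born ω).fst, R.lorentzCond ω x = (R.born ω).condKernel x := by
  by_cases h0 : R.born ω = 0
  · simp [h0]
  by_cases h : R.GloballyOriented ω
  · have hd := (R.born ω).disintegrate (R.born ω).condKernel
    filter_upwards [h] with x hx
    rw [lorentzCond, if_pos h]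
    have hs : (R.born ω).snd = (R.born ω Set.univ) • (R.born ω).condKernel x := by
      ext A hA
      have h1 : (R.born ω).snd A = ((R.born ω).fst ⊗ₘ (R.born ω).condKernel).snd A := by rw [hd]
      rw [h1, Measure.snd_apply hA, Measure.compProd_apply (measurable_snd hA)]
      have h2 : ∫⁻ a, (R.born ω).condKernel a (Prod.mk a ⁻¹' (Prod.snd ⁻¹' A)) ∂(R.born ω).fst
          = ∫⁻ a, (R.born ω).condKernel x A ∂(R.born ω).fst := by
        refine lintegral_congr_ae ?_
        filter_upwards [hx] with a ha
        rw [ha]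
        rfl
      rw [h2, lintegral_const, Measure.fst_univ, mul_comm]
      rfl
    rw [hs, smul_smul, ENNReal.inv_mul_cancel (by simpa using h0) (measure_ne_top _ _), one_smul]
  · filter_upwards [Measure.support_mem_ae] with x hx
    rw [lorentzCond, if_neg h, if_pos hx]

end RelativisticQRF

/-! ### Relational local quantum fields and vacuum kernels -/

section Fields

variable {s : ℕ} {HS : Type*} [NormedAddCommGroup HS] [InnerProductSpace ℂ HS] [CompleteSpace HS]
  {HR : Type*} [NormedAddCommGroup HR] [InnerProductSpace ℂ HR] [CompleteSpace HR]

/-- The relational local quantum field `x ↦ ∫ (x, λ) · φ dν(λ | x)`. -/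
def relField (V : SystemRep s HS) (R : RelativisticQRF s HR) (ω : State HR)
    (φ : HS →L[ℂ] HS) (x : Mink s) : HS →L[ℂ] HS :=
  weakIntegral (R.lorentzCond ω x) fun l => V.act (x, l) φ

/-- The `n`-point vacuum kernel `Tr[Ω φ₁(x₁) ⋯ φₙ(xₙ)]`. -/
def vacuumKernel (V : SystemRep s HS) (R : RelativisticQRF s HR) (Ω : State HS) {n : ℕ}
    (ω : Fin n → State HR) (φ : Fin n → HS →L[ℂ] HS) (x : Fin n → Mink s) : ℂ :=
  trace (Ω.1 * (List.ofFn fun i => relField V R (ω i) (φ i) (x i)).prod)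

/-- The difference-variable kernel, for `n + 1` points,
`Tr[Ω U(ξ₁ + ⋯ + ξₙ) φ₁(0) U(ξ₁)† φ₂(0) ⋯ U(ξₙ)† φₙ₊₁(0)]`. -/
def differenceKernel (V : SystemRep s HS) (R : RelativisticQRF s HR) (Ω : State HS) {n : ℕ}
    (ω : Fin (n + 1) → State HR) (φ : Fin (n + 1) → HS →L[ℂ] HS) (ξ : Fin n → Mink s) : ℂ :=
  trace (Ω.1 * (V.T (∑ j, ξ j) * relField V R (ω 0) (φ 0) 0 *
    (List.ofFn fun j : Fin n =>
      star (V.T (ξ j)) * relField V R (ω j.succ) (φ j.succ) 0).prod))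

end Fields

/-! ### Fourier transforms as tempered distributions -/

section Fourier

variable {s : ℕ}

/-- The tempered distribution `T` is the Fourier transform `p ↦ ∫ exp(i ∑ pⱼ · xⱼ) g(x) dx` of the
function `g`, with Minkowski products in the exponent:
`T(f) = ∫ g(x) (∫ exp(i ∑ pⱼ · xⱼ) f(p) dp) dx` for all test functions `f`, with an absolutely convergent integral. -/
def IsFourierTransform {n : ℕ} (g : (Fin n → Mink s) → ℂ) (T : 𝓢'(Fin n → Mink s, ℂ)) : Prop :=
  ∀ f : 𝓢(Fin n → Mink s, ℂ),
    Integrable (fun x => g x *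
      ∫ p : Fin n → Mink s, Complex.exp (Complex.I * ((∑ j, mdot (p j) (x j) : ℝ) : ℂ)) * f p) ∧
    T f = ∫ x, g x *
      ∫ p : Fin n → Mink s, Complex.exp (Complex.I * ((∑ j, mdot (p j) (x j) : ℝ) : ℂ)) * f p

/-- The momenta `(q₁, q₂ - q₁, …, qₙ - qₙ₋₁, -qₙ)`: the only `(p₁, …, pₙ₊₁)` with total momentum
zero and partial sums `p₁ + ⋯ + pⱼ = qⱼ`. -/
def momenta (s n : ℕ) : (Fin n → Mink s) →ₗ[ℝ] (Fin (n + 1) → Mink s) where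
  toFun q := fun k => (Fin.snoc (α := fun _ => Mink s) q 0 : Fin (n + 1) → Mink s) k -
    (Fin.cons (α := fun _ => Mink s) 0 q : Fin (n + 1) → Mink s) k
  map_add' q r := by
    funext k
    have h1 : (Fin.snoc (α := fun _ => Mink s) (q + r) 0 : Fin (n + 1) → Mink s) k =
        (Fin.snoc (α := fun _ => Mink s) q 0 : Fin (n + 1) → Mink s) k +
        (Fin.snoc (α := fun _ => Mink s) r 0 : Fin (n + 1) → Mink s) k := by
      refine Fin.lastCases ?_ (fun j => ?_) k <;> simp
    have h2 : (Fin.cons (α := fun _ => Mink s) 0 (q + r) : Fin (n + 1) → Mink s) k =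
        (Fin.cons (α := fun _ => Mink s) 0 q : Fin (n + 1) → Mink s) k +
        (Fin.cons (α := fun _ => Mink s) 0 r : Fin (n + 1) → Mink s) k := by
      refine Fin.cases ?_ (fun j => ?_) k <;> simp
    simp only [h1, h2, Pi.add_apply]
    abel
  map_smul' c q := by
    funext k
    have h1 : (Fin.snoc (α := fun _ => Mink s) (c • q) 0 : Fin (n + 1) → Mink s) k =
        c • (Fin.snoc (α := fun _ => Mink s) q 0 : Fin (n + 1) → Mink s) k := by
      refine Fin.lastCases ?_ (fun j => ?_) k <;> simp
    have h2 : (Fin.cons (α := fun _ => Mink s) 0 (c • q) : Fin (n + 1) → Mink s) k =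
        c • (Fin.cons (α := fun _ => Mink s) 0 q : Fin (n + 1) → Mink s) k := by
      refine Fin.cases ?_ (fun j => ?_) k <;> simp
    simp only [h1, h2, Pi.smul_apply, RingHom.id_apply, smul_sub]

lemma sum_momenta (n : ℕ) (q : Fin n → Mink s) : ∑ k, momenta s n q k = 0 := by
  simp [momenta, Finset.sum_sub_distrib, Fin.sum_univ_castSucc (fun k : Fin (n + 1) =>
    (Fin.snoc (α := fun _ => Mink s) q 0 : Fin (n + 1) → Mink s) k),
    Fin.sum_univ_succ (fun k : Fin (n + 1) =>
    (Fin.cons (α := fun _ => Mink s) 0 q : Fin (n + 1) → Mink s) k)]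

lemma momenta_castSucc (n : ℕ) (q : Fin n → Mink s) (j : Fin n) :
    momenta s n q j.castSucc =
      q j - (Fin.cons (α := fun _ => Mink s) 0 q : Fin (n + 1) → Mink s) j.castSucc := by
  simp [momenta]

lemma momenta_injective (n : ℕ) : Function.Injective (momenta s n) := by
  rw [← LinearMap.ker_eq_bot, LinearMap.ker_eq_bot']
  intro q hq
  have h : ∀ k : Fin (n + 1), (Fin.cons (α := fun _ => Mink s) 0 q : Fin (n + 1) → Mink s) k = 0 := by
    intro k
    induction k using Fin.induction with
    | zero => rfl
    | succ j ih =>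
      have h1 := momenta_castSucc n q j
      rw [hq, ih, Pi.zero_apply, sub_zero] at h1
      rw [Fin.cons_succ]
      exact h1.symm
  funext j
  exact h j.succ

lemma exists_antilipschitz_momenta (s n : ℕ) :
    ∃ K, AntilipschitzWith K (momenta s n).toContinuousLinearMap := by
  obtain ⟨K, -, hK⟩ := (momenta s n).exists_antilipschitzWith
    (LinearMap.ker_eq_bot.2 (momenta_injective n))
  exact ⟨K, hK⟩

/-- The tempered distribution `δ(p₁ + ⋯ + pₙ₊₁) T(p₁, p₁ + p₂, …, p₁ + ⋯ + pₙ)`. In the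
coordinates `qⱼ = p₁ + ⋯ + pⱼ`, `P = p₁ + ⋯ + pₙ₊₁`, which have Jacobian one, it is `T(q) ⊗ δ(P)`, so
that a test function is restricted to `P = 0` and then paired with `T`. -/
def deltaTotal {n : ℕ} (T : 𝓢'(Fin n → Mink s, ℂ)) : 𝓢'(Fin (n + 1) → Mink s, ℂ) :=
  PointwiseConvergenceCLM.precomp ℂ (SchwartzMap.compCLMOfAntilipschitz ℂ
    (momenta s n).toContinuousLinearMap.hasTemperateGrowth
    (exists_antilipschitz_momenta s n).choose_spec) T

lemma deltaTotal_apply {n : ℕ} (T : 𝓢'(Fin n → Mink s, ℂ)) (f : 𝓢(Fin (n + 1) → Mink s, ℂ))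
    (g : 𝓢(Fin n → Mink s, ℂ)) (hg : ∀ q, g q = f (momenta s n q)) : deltaTotal T f = T g := by
  have e : g = SchwartzMap.compCLMOfAntilipschitz ℂ
      (momenta s n).toContinuousLinearMap.hasTemperateGrowth
      (exists_antilipschitz_momenta s n).choose_spec f := by
    ext q
    exact hg q
  rw [e]
  rfl

end Fourier

end RQFT

end

/-! An invariant density operator behaves like a vacuum. Ω commutes with every U(g), hence so does
√Ω, and the Hilbert-Schmidt norm of (U(a) - 1)√Ω depends only on the Lorentz orbit of a. For a
light-like vector a of the form c(e₀ ± eᵢ) a boost halves a, so the orbit contains 2⁻ᵏa for all k,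
and strong continuity forces the norm to be zero. These vectors span Minkowski space once there is a
space dimension, so U(a)√Ω = √Ω for all a (`T_mul_sqrt`).

Global orientation makes the fields translation covariant, φ(x) = U(x) φ(0) U(x)† (`relField_eq`).
In a product of fields neighbouring translations merge and Ω absorbs the outer ones. Both kernels
therefore come from one bounded continuous function G: the difference kernel is G(ξ), and the vacuum
kernel is G at the successive differences of the xᵢ (`vacuumKernel_eq`, `differenceKernel_eq`). Such
functions have tempered Fourier transforms. Pass to differences in position space and to partial
sums in momentum space, which are transposed maps of Jacobian one. The last position y then enters
only through the phase exp(i P · y) of the total momentum P, and Fourier inversion in y yields (2π)ᵈ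
and sets P = 0 (`integral_mul_prodFT_of_differences`).

For the support, a shift of ξⱼ by η inserts a single U(η)† into the operator product. Multiplying a
test function by h(qⱼ) thus inserts ∫ ĥ(η) U(η)† dη = (2π)ᵈ h(P). If h is a narrow cutoff around a
point off the joint spectrum this operator is zero, since a nonzero h(P)v would be an approximate
joint eigenvector (`exists_bump_spectralVec_eq_zero`). A covering argument passes from cutoffs to
all test functions supported off the spectrum (`integral_mul_prodFT_eq_zero_of_local`). -/

namespace RQFT

/-! ### The unitary group of translations. -/

section Translations

variable {s : ℕ} {H : Type*} [NormedAddCommGroup H] [InnerProductSpace ℂ H] [CompleteSpace H]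

@[simp] lemma lorentzAct_one (x : Mink s) : lorentzAct 1 x = x := by
  simp [lorentzAct]

@[simp] lemma lorentzAct_zero (L : Lorentz s) : lorentzAct L 0 = 0 := by
  simp [lorentzAct]

lemma lorentzAct_smul (L : Lorentz s) (c : ℝ) (x : Mink s) :
    lorentzAct L (c • x) = c • lorentzAct L x := by
  simp [lorentzAct, Matrix.mulVec_smul]

namespace SystemRep

variable (V : SystemRep s H)

lemma T_mul_T (a b : Mink s) : V.T a * V.T b = V.T (a + b) := by
  have h := congrArg (Subtype.val) (V.transl_comp a (transl b))
  simpa [T, transl, Poincare.comp, add_comm] using h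

lemma star_T_mul_T (a : Mink s) : star (V.T a) * V.T a = 1 :=
  Unitary.star_mul_self_of_mem (V.U (transl a)).2

@[simp] lemma T_zero : V.T 0 = 1 := by
  have h := V.T_mul_T 0 0
  rw [add_zero] at h
  calc V.T 0 = star (V.T 0) * (V.T 0 * V.T 0) := by rw [← mul_assoc, star_T_mul_T, one_mul]
    _ = 1 := by rw [h, star_T_mul_T]

lemma star_T (a : Mink s) : star (V.T a) = V.T (-a) := by
  calc star (V.T a) = star (V.T a) * (V.T a * V.T (-a)) := by simp [T_mul_T]
    _ = V.T (-a) := by rw [← mul_assoc, star_T_mul_T, one_mul]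

lemma inner_T_left (a : Mink s) (x y : H) : ⟪V.T a x, y⟫_ℂ = ⟪x, V.T (-a) y⟫_ℂ := by
  rw [← star_T, ContinuousLinearMap.star_eq_adjoint, ContinuousLinearMap.adjoint_inner_right]

lemma T_T_apply (a b : Mink s) (x : H) : V.T a (V.T b x) = V.T (a + b) x := by
  rw [← T_mul_T]; rfl

@[simp] lemma norm_T_apply (a : Mink s) (x : H) : ‖V.T a x‖ = ‖x‖ := by
  have h : ⟪V.T a x, V.T a x⟫_ℂ = ⟪x, x⟫_ℂ := by
    rw [inner_T_left, T_T_apply, neg_add_cancel, T_zero]; rfl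
  rw [inner_self_eq_norm_sq_to_K, inner_self_eq_norm_sq_to_K] at h
  have h' : ‖V.T a x‖ ^ 2 = ‖x‖ ^ 2 := by exact_mod_cast h
  exact (sq_eq_sq₀ (norm_nonneg _) (norm_nonneg _)).1 h'

lemma norm_T_le (a : Mink s) : ‖V.T a‖ ≤ 1 :=
  ContinuousLinearMap.opNorm_le_bound _ zero_le_one fun x => by simp

/-- Weak continuity is strong continuity here: the norms are constant, so the squared distance is
2‖x‖² minus twice the real part of an inner product. -/
lemma continuous_T_apply (x : H) : Continuous fun a => V.T a x := by
  rw [continuous_iff_continuousAt]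
  intro a
  rw [ContinuousAt, tendsto_iff_norm_sub_tendsto_zero]
  have h1 : ∀ b, ‖V.T b x - V.T a x‖ = √(2 * ‖x‖ ^ 2 - 2 * RCLike.re ⟪V.T a x, V.T b x⟫_ℂ) := by
    intro b
    rw [← Real.sqrt_sq (norm_nonneg (V.T b x - V.T a x)), @norm_sub_sq ℂ, norm_T_apply,
      norm_T_apply, ← inner_conj_symm, RCLike.conj_re]
    congr 1; ring
  have h2 : Continuous fun b => √(2 * ‖x‖ ^ 2 - 2 * RCLike.re ⟪V.T a x, V.T b x⟫_ℂ) :=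
    (continuous_const.sub (continuous_const.mul
      (RCLike.continuous_re.comp (V.continuous_transl _ _)))).sqrt
  have h3 := h2.tendsto a
  simp_rw [h1]
  convert h3 using 2
  rw [← h1, sub_self, norm_zero]

/-- Both (0, L)(a, 1) and (La, 1)(0, L) equal (La, L). No phase appears because each product has a
translation as a factor. -/
lemma conj_T (L : Lorentz s) (a : Mink s) :
    (V.U (0, L) : H →L[ℂ] H) * V.T a * star (V.U (0, L) : H →L[ℂ] H) = V.T (lorentzAct L a) := by
  have h : V.U (0, L) * V.U (transl a) = V.U (transl (lorentzAct L a)) * V.U (0, L) := by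
    rw [V.comp_transl, V.transl_comp]
    simp [transl, Poincare.comp]
  have h' : (V.U (0, L) : H →L[ℂ] H) * V.T a = V.T (lorentzAct L a) * V.U (0, L) :=
    congrArg Subtype.val h
  rw [h', mul_assoc, Unitary.mul_star_self_of_mem (V.U (0, L)).2, mul_one]

lemma act_eq (x : Mink s) (L : Lorentz s) (A : H →L[ℂ] H) :
    V.act (x, L) A = V.T x * V.act (0, L) A * star (V.T x) := by
  have h : V.U (x, L) = V.U (transl x) * V.U (0, L) := by
    rw [V.transl_comp]; simp [transl, Poincare.comp]
  simp [ProjectiveRep.act, h, T, mul_assoc]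

end SystemRep

end Translations

/-! ### Hilbert-Schmidt norms and normal states. -/

section HilbertSchmidt

variable {H : Type*} [NormedAddCommGroup H] [InnerProductSpace ℂ H] [CompleteSpace H]

/-- The square of the Hilbert-Schmidt norm, with values in `ℝ≥0∞`. -/
noncomputable def hsSq (X : H →L[ℂ] H) : ℝ≥0∞ := ∑' i, ENNReal.ofReal (‖X (basis H i)‖ ^ 2)

/-- By Parseval both sides are the double sum of the squared moduli of the matrix elements; with
values in `ℝ≥0∞` the order of summation is free. -/
lemma hsSq_star (X : H →L[ℂ] H) : hsSq (star X) = hsSq X := by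
  have h : ∀ (Y : H →L[ℂ] H) i, ENNReal.ofReal (‖Y (basis H i)‖ ^ 2) =
      ∑' j, ENNReal.ofReal (‖⟪basis H j, Y (basis H i)⟫_ℂ‖ ^ 2) := fun Y i => by
    have h := basis_sq (basis H) (Y (basis H i))
    rw [← h.tsum_eq]
    exact ENNReal.ofReal_tsum_of_nonneg (fun j => sq_nonneg _) h.summable
  unfold hsSq
  simp_rw [h]
  rw [ENNReal.tsum_comm]
  congr 1; funext i; congr 1; funext j
  rw [ContinuousLinearMap.star_eq_adjoint, ContinuousLinearMap.adjoint_inner_right,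
    norm_inner_symm]

lemma norm_unitary_apply (U : unitary (H →L[ℂ] H)) (x : H) : ‖(U : H →L[ℂ] H) x‖ = ‖x‖ := by
  have h : ⟪(U : H →L[ℂ] H) x, (U : H →L[ℂ] H) x⟫_ℂ = ⟪x, x⟫_ℂ := by
    rw [← ContinuousLinearMap.adjoint_inner_right, ← ContinuousLinearMap.star_eq_adjoint]
    have : (star (U : H →L[ℂ] H)) ((U : H →L[ℂ] H) x) = x :=
      congrArg (fun A : H →L[ℂ] H => A x) (Unitary.star_mul_self_of_mem U.2)
    rw [this]
  rw [inner_self_eq_norm_sq_to_K, inner_self_eq_norm_sq_to_K] at h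
  have h' : ‖(U : H →L[ℂ] H) x‖ ^ 2 = ‖x‖ ^ 2 := by exact_mod_cast h
  exact (sq_eq_sq₀ (norm_nonneg _) (norm_nonneg _)).1 h'

lemma hsSq_unitary_mul (U : unitary (H →L[ℂ] H)) (X : H →L[ℂ] H) :
    hsSq ((U : H →L[ℂ] H) * X) = hsSq X := by
  simp [hsSq, norm_unitary_apply]

lemma hsSq_mul_star_unitary (U : unitary (H →L[ℂ] H)) (X : H →L[ℂ] H) :
    hsSq (X * star (U : H →L[ℂ] H)) = hsSq X := by
  rw [← hsSq_star, star_mul, star_star, hsSq_unitary_mul, hsSq_star]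

lemma hsSq_eq_zero {X : H →L[ℂ] H} (h : hsSq X = 0) : X = 0 := by
  have h1 : hsSq (star X) = 0 := by rw [hsSq_star, h]
  have h0 : ∀ i, star X (basis H i) = 0 := fun i => by
    have := ENNReal.tsum_eq_zero.1 h1 i
    rw [ENNReal.ofReal_eq_zero] at this
    exact norm_eq_zero.1 (pow_eq_zero_iff two_ne_zero |>.1 (le_antisymm this (sq_nonneg _)))
  ext x
  have h2 := basis_sq (basis H) (X x)
  have h3 : ∀ i, ⟪basis H i, X x⟫_ℂ = 0 := fun i => by
    rw [← ContinuousLinearMap.adjoint_inner_left, ← ContinuousLinearMap.star_eq_adjoint, h0,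
      inner_zero_left]
  simp only [h3, norm_zero, ne_eq, OfNat.ofNat_ne_zero, not_false_eq_true, zero_pow] at h2
  have h4 := h2.unique hasSum_zero
  exact norm_eq_zero.1 (pow_eq_zero_iff two_ne_zero |>.1 h4)

lemma IsDensity.hasSum_norm_sqrt {ρ : H →L[ℂ] H} (hρ : IsDensity ρ) :
    HasSum (fun i => ‖CFC.sqrt ρ (basis H i)‖ ^ 2) 1 := by
  have h := Complex.reCLM.hasSum hρ.hasSum
  have hs := sqrt_spec hρ.pos
  convert h using 2 with i
  swap; · simp
  change _ = (⟪basis H i, ρ (basis H i)⟫_ℂ).re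
  have : ρ (basis H i) = CFC.sqrt ρ (CFC.sqrt ρ (basis H i)) := by
    nth_rw 1 [← hs.1]; rfl
  rw [this, ← hs.2, inner_self_eq_norm_sq_to_K]; norm_cast

/-- The vectors √ρ eᵢ have squared norms that sum to one, so the trace is dominated termwise by ‖B‖
times these. -/
lemma norm_trace_density_mul_le {ρ : H →L[ℂ] H} (hρ : IsDensity ρ) (B : H →L[ℂ] H) :
    ‖trace (ρ * B)‖ ≤ ‖B‖ := by
  have h := hρ.hasSum_sqrt B
  have hb : ∀ i, ‖⟪CFC.sqrt ρ (basis H i), B (CFC.sqrt ρ (basis H i))⟫_ℂ‖ ≤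
      ‖B‖ * ‖CFC.sqrt ρ (basis H i)‖ ^ 2 := fun i => by
    refine (norm_inner_le_norm _ _).trans ?_
    nlinarith [B.le_opNorm (CFC.sqrt ρ (basis H i)), norm_nonneg (CFC.sqrt ρ (basis H i))]
  have h2 := hρ.hasSum_norm_sqrt.mul_left ‖B‖
  rw [← h.tsum_eq]
  simpa [h2.tsum_eq] using tsum_of_norm_bounded h2 hb

/-- A normal state is continuous along bounded families that are weakly continuous. -/
lemma tendsto_trace_density_mul {α : Type*} {l : Filter α} {ρ : H →L[ℂ] H} (hρ : IsDensity ρ)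
    {B : α → H →L[ℂ] H} {B₀ : H →L[ℂ] H} {C : ℝ} (hC : ∀ a, ‖B a‖ ≤ C)
    (h : ∀ x, Filter.Tendsto (fun a => ⟪x, B a x⟫_ℂ) l (nhds ⟪x, B₀ x⟫_ℂ)) :
    Filter.Tendsto (fun a => trace (ρ * B a)) l (nhds (trace (ρ * B₀))) := by
  rw [← (hρ.hasSum_sqrt B₀).tsum_eq]
  have e : (fun a => trace (ρ * B a)) = fun a =>
      ∑' i, ⟪CFC.sqrt ρ (basis H i), B a (CFC.sqrt ρ (basis H i))⟫_ℂ :=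
    funext fun a => (hρ.hasSum_sqrt (B a)).tsum_eq.symm
  rw [e]
  -- Each term converges by weak continuity, and the uniform bound C on the norms gives a summable
  -- majorant of total mass C.
  refine tendsto_tsum_of_dominated_convergence
    (bound := fun i => C * ‖CFC.sqrt ρ (basis H i)‖ ^ 2)
    (hρ.hasSum_norm_sqrt.mul_left C).summable (fun i => h _) ?_
  refine Filter.Eventually.of_forall fun a i => ?_
  refine (norm_inner_le_norm _ _).trans ?_
  nlinarith [(B a).le_of_opNorm_le (hC a) (CFC.sqrt ρ (basis H i)),
    norm_nonneg (CFC.sqrt ρ (basis H i))]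

end HilbertSchmidt

/-! ### Boosts that rescale a light-like direction. -/

section Boosts

lemma vecMulVec_mul_vecMulVec' {ι : Type*} [Fintype ι] (a b c d : ι → ℝ) :
    vecMulVec a b * vecMulVec c d = (b ⬝ᵥ c) • vecMulVec a d := by
  ext i j
  simp only [Matrix.mul_apply, vecMulVec_apply, dotProduct, Matrix.smul_apply, smul_eq_mul,
    Finset.sum_mul]
  exact Finset.sum_congr rfl fun k _ => by ring

/-- The boost with light-cone directions `u`, `v` that scales `u` by `r` and `v` by `r⁻¹`. -/
noncomputable def boostMatrix {ι : Type*} [DecidableEq ι] (u v : ι → ℝ) (r : ℝ) : Matrix ι ι ℝ :=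
  1 + ((r - 1) / 2) • vecMulVec u u + ((r⁻¹ - 1) / 2) • vecMulVec v v

section

variable {ι : Type*} [Fintype ι] [DecidableEq ι] {u v : ι → ℝ}

/-- As u and v are orthogonal of squared length 2, uuᵀ/2 and vvᵀ/2 are orthogonal projections with
product zero. The boost acts by r, by r⁻¹ and by 1 on the respective subspaces. -/
lemma boostMatrix_mul (huu : u ⬝ᵥ u = 2) (hvv : v ⬝ᵥ v = 2) (huv : u ⬝ᵥ v = 0) (r r' : ℝ) :
    boostMatrix u v r * boostMatrix u v r' = boostMatrix u v (r * r') := by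
  have hvu : v ⬝ᵥ u = 0 := by rw [dotProduct_comm, huv]
  simp only [boostMatrix, mul_add, add_mul, one_mul, mul_one, smul_mul_smul_comm,
    vecMulVec_mul_vecMulVec', huu, hvv, huv, hvu, zero_smul, smul_zero, add_zero,
    smul_smul, mul_inv]
  module

lemma boostMatrix_mulVec (huu : u ⬝ᵥ u = 2) (huv : u ⬝ᵥ v = 0) (r : ℝ) : boostMatrix u v r *ᵥ u = r • u := by
  have hvu : v ⬝ᵥ u = 0 := by rw [dotProduct_comm, huv]
  simp only [boostMatrix, add_mulVec, one_mulVec, smul_mulVec, vecMulVec_mulVec, huu, hvu]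
  ext i
  simp only [Pi.add_apply, Pi.smul_apply, MulOpposite.op_zero, zero_smul, smul_eq_mul,
    MulOpposite.smul_eq_mul_unop, MulOpposite.unop_op]
  simp
  ring

lemma boostMatrix_mul_inv (huu : u ⬝ᵥ u = 2) (hvv : v ⬝ᵥ v = 2) (huv : u ⬝ᵥ v = 0) {r : ℝ} (hr : r ≠ 0) :
    boostMatrix u v r * boostMatrix u v r⁻¹ = 1 := by
  rw [boostMatrix_mul huu hvv huv, mul_inv_cancel₀ hr]
  simp [boostMatrix]

/-- The boost with parameter r is the square of the invertible boost with parameter √r. -/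
lemma boostMatrix_det_pos (huu : u ⬝ᵥ u = 2) (hvv : v ⬝ᵥ v = 2) (huv : u ⬝ᵥ v = 0) {r : ℝ}
    (hr : 0 < r) : 0 < (boostMatrix u v r).det := by
  have h := boostMatrix_mul_inv huu hvv huv (Real.sqrt_pos.2 hr).ne'
  have h1 : (boostMatrix u v √r).det ≠ 0 := fun h0 => by
    have := congrArg Matrix.det h
    simp [h0] at this
  rw [← Real.mul_self_sqrt hr.le, ← boostMatrix_mul huu hvv huv, Matrix.det_mul]
  exact mul_self_pos.2 h1

end

variable {s : ℕ}

/-- The light-like vector `e₀ + ε eᵢ`. -/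
noncomputable def lightVec (i : Fin s) (ε : ℝ) : Fin (s + 1) → ℝ :=
  Pi.single 0 1 + ε • Pi.single i.succ 1

lemma lightVec_dot (i : Fin s) (ε ε' : ℝ) : lightVec i ε ⬝ᵥ lightVec i ε' = 1 + ε * ε' := by
  simp [lightVec, dotProduct_add, Fin.succ_ne_zero, mul_comm]

lemma eta_lightVec (i : Fin s) (ε : ℝ) : eta s *ᵥ lightVec i ε = lightVec i (-ε) := by
  ext k
  rw [eta, mulVec_diagonal]
  refine Fin.cases ?_ (fun j => ?_) k
  · simp [lightVec, (Fin.succ_ne_zero i).symm]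
  · simp [lightVec, Fin.succ_ne_zero]

/-- The metric exchanges u = e₀ + εeᵢ and v = e₀ - εeᵢ, so conjugation by it inverts the boost B.
Since B is symmetric, this is the Lorentz condition. The determinant squares to one and is positive.
-/
lemma exists_lorentz_scaling (i : Fin s) {ε : ℝ} (hε : ε * ε = 1) :
    ∃ L : Lorentz s, lorentzAct L (WithLp.toLp 2 (lightVec i ε)) =
      (1 / 2 : ℝ) • WithLp.toLp 2 (lightVec i ε) := by
  set u := lightVec i ε with hu
  set v := lightVec i (-ε) with hv
  have huu : u ⬝ᵥ u = 2 := by rw [hu, lightVec_dot, hε]; norm_num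
  have hvv : v ⬝ᵥ v = 2 := by rw [hv, lightVec_dot, neg_mul_neg, hε]; norm_num
  have huv : u ⬝ᵥ v = 0 := by rw [hu, hv, lightVec_dot, mul_neg, hε]; norm_num
  have hηu : eta s *ᵥ u = v := eta_lightVec i ε
  have hηv : eta s *ᵥ v = u := by rw [hv, eta_lightVec, neg_neg]
  have hηT : (eta s)ᵀ = eta s := by rw [eta, Matrix.diagonal_transpose]
  have hconj : ∀ w : Fin (s + 1) → ℝ, eta s * vecMulVec w w * eta s =
      vecMulVec (eta s *ᵥ w) (eta s *ᵥ w) := fun w => by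
    rw [mul_vecMulVec, vecMulVec_mul, ← mulVec_transpose, hηT]
  have hη : ∀ r : ℝ, eta s * boostMatrix u v r * eta s = boostMatrix u v r⁻¹ := fun r => by
    simp only [boostMatrix, mul_add, add_mul, Matrix.mul_smul, Matrix.smul_mul, hconj, hηu, hηv,
      mul_one, eta_sq, inv_inv]
    abel
  set B := boostMatrix u v (1 / 2) with hB
  have hT : Bᵀ = B := by simp [hB, boostMatrix, transpose_vecMulVec]
  have hBB : Bᵀ * eta s * B = eta s := by
    rw [hT]
    calc B * eta s * B = B * (eta s * B * eta s) * eta s := by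
          simp only [Matrix.mul_assoc, eta_sq, Matrix.mul_one]
      _ = eta s := by
        rw [hη, boostMatrix_mul_inv huu hvv huv (by norm_num), Matrix.one_mul]
  have hdet : B.det = 1 := by
    have hpos : 0 < B.det := boostMatrix_det_pos huu hvv huv (by norm_num)
    have h1 := congrArg Matrix.det hBB
    have h2 : (eta s).det ≠ 0 := fun h0 => by
      have := congrArg Matrix.det (eta_sq s)
      simp [h0] at this
    rw [Matrix.det_mul, Matrix.det_mul, Matrix.det_transpose, mul_right_comm] at h1
    have h3 : B.det * B.det = 1 := mul_right_cancel₀ h2 (by rw [h1, one_mul])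
    nlinarith
  -- The entry is 1 - 1/4 + 1/2 = 5/4.
  have h00 : 1 ≤ B 0 0 := by
    have hu0 : u 0 = 1 := by simp [hu, lightVec, (Fin.succ_ne_zero i).symm]
    have hv0 : v 0 = 1 := by simp [hv, lightVec, (Fin.succ_ne_zero i).symm]
    simp only [hB, boostMatrix, Matrix.add_apply, Matrix.smul_apply, vecMulVec_apply, hu0, hv0,
      Matrix.one_apply_eq, smul_eq_mul]
    norm_num
  refine ⟨⟨⟨B, hdet⟩, hBB, h00⟩, ?_⟩
  change WithLp.toLp 2 (B *ᵥ u) = _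
  rw [hB, boostMatrix_mulVec huu huv]
  rfl

end Boosts

/-! ### Translations act trivially on invariant states. -/

section InvariantStates

variable {s : ℕ} {H : Type*} [NormedAddCommGroup H] [InnerProductSpace ℂ H] [CompleteSpace H]
  (V : SystemRep s H) {Ω : State H}

/-- Invariance is a statement about conjugation, so phases drop out and Ω commutes with U(g); the
functional calculus of Ω inherits this. -/
lemma SystemRep.IsInvariant.commute_sqrt (hΩ : V.IsInvariant Ω) (g : Poincare s) :
    Commute (CFC.sqrt Ω.1) (V.U g : H →L[ℂ] H) := by
  have h : Commute Ω.1 (V.U g : H →L[ℂ] H) := by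
    have h1 := congrArg (fun A => (V.U g : H →L[ℂ] H) * A) (hΩ g)
    simp only [← mul_assoc, Unitary.mul_star_self_of_mem (V.U g).2, one_mul] at h1
    exact h1
  have h0 : 0 ≤ Ω.1 := (ContinuousLinearMap.nonneg_iff_isPositive _).2 Ω.2.pos
  rw [CFC.sqrt_eq_cfc]
  exact Commute.cfc_nnreal h _

/-- Conjugation by U(0, L) carries (U(a) - 1)√Ω to the same expression at La, because it fixes √Ω.
Unitaries do not change the Hilbert-Schmidt norm. -/
lemma hsSq_T_sub_one_mul_sqrt (hΩ : V.IsInvariant Ω) (L : Lorentz s) (a : Mink s) :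
    hsSq ((V.T (lorentzAct L a) - 1) * CFC.sqrt Ω.1) = hsSq ((V.T a - 1) * CFC.sqrt Ω.1) := by
  have h1 : (V.T (lorentzAct L a) - 1) * CFC.sqrt Ω.1 =
      (V.U (0, L) : H →L[ℂ] H) * ((V.T a - 1) * CFC.sqrt Ω.1) *
        star (V.U (0, L) : H →L[ℂ] H) := by
    have hc := (hΩ.commute_sqrt V (0, L)).eq
    have hu := Unitary.mul_star_self_of_mem (V.U (0, L)).2
    have hc' : star (V.U (0, L) : H →L[ℂ] H) * CFC.sqrt Ω.1 =
        CFC.sqrt Ω.1 * star (V.U (0, L) : H →L[ℂ] H) := by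
      have := Unitary.star_mul_self_of_mem (V.U (0, L)).2
      calc _ = star (V.U (0, L) : H →L[ℂ] H) * CFC.sqrt Ω.1 *
            ((V.U (0, L) : H →L[ℂ] H) * star (V.U (0, L) : H →L[ℂ] H)) := by rw [hu, mul_one]
        _ = star (V.U (0, L) : H →L[ℂ] H) * (CFC.sqrt Ω.1 *
            (V.U (0, L) : H →L[ℂ] H)) * star (V.U (0, L) : H →L[ℂ] H) := by
              simp only [mul_assoc]
        _ = _ := by rw [hc, ← mul_assoc, this, one_mul]
    rw [← V.conj_T]
    calc ((V.U (0, L) : H →L[ℂ] H) * V.T a * star (V.U (0, L) : H →L[ℂ] H) - 1) * CFC.sqrt Ω.1 =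
          ((V.U (0, L) : H →L[ℂ] H) * V.T a * star (V.U (0, L) : H →L[ℂ] H) -
          (V.U (0, L) : H →L[ℂ] H) * star (V.U (0, L) : H →L[ℂ] H)) * CFC.sqrt Ω.1 := by rw [hu]
      _ = (V.U (0, L) : H →L[ℂ] H) * (V.T a - 1) *
          (star (V.U (0, L) : H →L[ℂ] H) * CFC.sqrt Ω.1) := by
        rw [mul_sub, sub_mul, sub_mul, mul_one]; simp only [mul_assoc]
      _ = _ := by rw [hc']; simp only [mul_assoc]
  rw [h1, hsSq_mul_star_unitary, hsSq_unitary_mul]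

/-- Each term tends to zero by strong continuity, and 4‖√Ω eᵢ‖² dominates since ‖U(a) - 1‖ ≤ 2. -/
lemma tendsto_hsSq_T_sub_one (a : Mink s) {t : ℕ → ℝ} (ht : Filter.Tendsto t .atTop (nhds 0)) :
    Filter.Tendsto (fun k => hsSq ((V.T (t k • a) - 1) * CFC.sqrt Ω.1)) .atTop (nhds 0) := by
  have hsum := (Ω.2.hasSum_norm_sqrt.mul_left 4).summable
  have hle : ∀ k i, ‖((V.T (t k • a) - 1) * CFC.sqrt Ω.1) (basis H i)‖ ^ 2 ≤
      4 * ‖CFC.sqrt Ω.1 (basis H i)‖ ^ 2 := fun k i => by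
    have : ‖((V.T (t k • a) - 1) * CFC.sqrt Ω.1) (basis H i)‖ ≤
        2 * ‖CFC.sqrt Ω.1 (basis H i)‖ := by
      change ‖V.T (t k • a) (CFC.sqrt Ω.1 (basis H i)) - CFC.sqrt Ω.1 (basis H i)‖ ≤ _
      refine (norm_sub_le _ _).trans ?_
      rw [V.norm_T_apply, two_mul]
    nlinarith [norm_nonneg (((V.T (t k • a) - 1) * CFC.sqrt Ω.1) (basis H i))]
  have h : Filter.Tendsto (fun k => ∑' i, ‖((V.T (t k • a) - 1) * CFC.sqrt Ω.1) (basis H i)‖ ^ 2)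
      .atTop (nhds (∑' i : basisIndex H, (0 : ℝ))) := by
    refine tendsto_tsum_of_dominated_convergence hsum (fun i => ?_)
      (Filter.Eventually.of_forall fun k i => ?_)
    · have h1 : Filter.Tendsto (fun k => V.T (t k • a) (CFC.sqrt Ω.1 (basis H i))) .atTop
          (nhds (CFC.sqrt Ω.1 (basis H i))) := by
        have := ((V.continuous_T_apply (CFC.sqrt Ω.1 (basis H i))).tendsto 0).comp
          (by simpa using ht.smul_const a :
            Filter.Tendsto (fun k => t k • a) .atTop (nhds 0))
        rw [V.T_zero] at this
        exact this
      have h2 := ((h1.sub_const (CFC.sqrt Ω.1 (basis H i))).norm).pow 2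
      simpa using h2
    · rw [Real.norm_of_nonneg (sq_nonneg _)]
      exact hle k i
  have h' := ENNReal.tendsto_ofReal h
  simp only [tsum_zero, ENNReal.ofReal_zero] at h'
  refine h'.congr fun k => ?_
  exact ENNReal.ofReal_tsum_of_nonneg (fun i => sq_nonneg _)
    (Summable.of_nonneg_of_le (fun i => sq_nonneg _) (hle k) hsum)

/-- Along the sequence 2⁻ᵏa the Hilbert-Schmidt norm is constant, by boost invariance, and tends to
zero, by continuity. So it vanishes at a. -/
lemma T_light_mul_sqrt (hΩ : V.IsInvariant Ω) (i : Fin s) {ε : ℝ} (hε : ε * ε = 1) (c : ℝ) :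
    V.T (c • WithLp.toLp 2 (lightVec i ε)) * CFC.sqrt Ω.1 = CFC.sqrt Ω.1 := by
  obtain ⟨L, hL⟩ := exists_lorentz_scaling i hε
  set a : Mink s := c • WithLp.toLp 2 (lightVec i ε) with ha
  have hLa : ∀ t : ℝ, lorentzAct L (t • a) = (t * (1 / 2)) • a := fun t => by
    rw [lorentzAct_smul, ha, lorentzAct_smul, hL, smul_comm c, smul_smul]
  have hk : ∀ k : ℕ, hsSq ((V.T (((1 / 2 : ℝ) ^ k) • a) - 1) * CFC.sqrt Ω.1) =
      hsSq ((V.T a - 1) * CFC.sqrt Ω.1) := fun k => by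
    induction k with
    | zero => simp
    | succ k ih => rw [pow_succ, ← hLa, hsSq_T_sub_one_mul_sqrt V hΩ, ih]
  have ht := tendsto_hsSq_T_sub_one V (Ω := Ω) a
    (tendsto_pow_atTop_nhds_zero_of_lt_one (by norm_num) (by norm_num : (1 / 2 : ℝ) < 1))
  simp_rw [hk] at ht
  have h0 := hsSq_eq_zero (tendsto_nhds_unique tendsto_const_nhds ht)
  rw [sub_mul, one_mul, sub_eq_zero] at h0
  exact h0

/-- Invariant density operators are vacuum-like: translations act trivially on their range. -/
lemma T_mul_sqrt (hs : 1 ≤ s) (hΩ : V.IsInvariant Ω) (a : Mink s) :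
    V.T a * CFC.sqrt Ω.1 = CFC.sqrt Ω.1 := by
  have hadd : ∀ a b : Mink s, V.T a * CFC.sqrt Ω.1 = CFC.sqrt Ω.1 →
      V.T b * CFC.sqrt Ω.1 = CFC.sqrt Ω.1 → V.T (a + b) * CFC.sqrt Ω.1 = CFC.sqrt Ω.1 :=
    fun a b ha hb => by rw [← V.T_mul_T, mul_assoc, hb, ha]
  have hspace : ∀ (i : Fin s) (c : ℝ),
      V.T (c • EuclideanSpace.single i.succ 1) * CFC.sqrt Ω.1 = CFC.sqrt Ω.1 := fun i c => by
    -- eᵢ is half the difference of the light-like vectors e₀ + eᵢ and e₀ - eᵢ.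
    have e : (c • EuclideanSpace.single i.succ 1 : Mink s) =
        (c / 2) • WithLp.toLp 2 (lightVec i 1) + (-(c / 2)) • WithLp.toLp 2 (lightVec i (-1)) := by
      ext k
      simp [lightVec]
      split_ifs <;> ring
    rw [e]
    exact hadd _ _ (T_light_mul_sqrt V hΩ i (by norm_num) _)
      (T_light_mul_sqrt V hΩ i (by norm_num) _)
  have htime : ∀ c : ℝ,
      V.T (c • EuclideanSpace.single 0 1) * CFC.sqrt Ω.1 = CFC.sqrt Ω.1 := fun c => by
    -- A space direction is needed here: e₀ is the light-like vector e₀ + eᵢ minus eᵢ.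
    let i : Fin s := ⟨0, hs⟩
    have e : (c • EuclideanSpace.single 0 1 : Mink s) =
        c • WithLp.toLp 2 (lightVec i 1) + (-c) • EuclideanSpace.single i.succ 1 := by
      ext k
      simp [lightVec]
    rw [e]
    exact hadd _ _ (T_light_mul_sqrt V hΩ i (by norm_num) _) (hspace i _)
  have e : a = ∑ k, a k • (EuclideanSpace.single k 1 : Mink s) := by
    ext j
    simp [Finset.sum_apply, Pi.single_apply]
  rw [e]
  refine Finset.sum_induction _ (fun b : Mink s => V.T b * CFC.sqrt Ω.1 = CFC.sqrt Ω.1) hadd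
    (by simp) fun k _ => ?_
  exact Fin.cases (htime _) (fun j => hspace j _) k

end InvariantStates

/-! ### Translation covariance of the relational fields. -/

section Fields

variable {s : ℕ} {HS : Type*} [NormedAddCommGroup HS] [InnerProductSpace ℂ HS] [CompleteSpace HS]
  {HR : Type*} [NormedAddCommGroup HR] [InnerProductSpace ℂ HR] [CompleteSpace HR]

lemma ProjectiveRep.norm_act_le (V : ProjectiveRep s HS) (g : Poincare s) (A : HS →L[ℂ] HS) :
    ‖V.act g A‖ ≤ ‖A‖ := by
  have h : ∀ U : unitary (HS →L[ℂ] HS), ‖(U : HS →L[ℂ] HS)‖ ≤ 1 := fun U =>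
    ContinuousLinearMap.opNorm_le_bound _ zero_le_one fun x => by simp [norm_unitary_apply]
  calc ‖V.act g A‖ ≤ ‖(V.U g : HS →L[ℂ] HS)‖ * ‖A‖ * ‖star (V.U g : HS →L[ℂ] HS)‖ :=
        norm_mul₃_le
    _ ≤ 1 * ‖A‖ * 1 := by
        gcongr
        · exact h _
        · rw [norm_star]; exact h _
    _ = ‖A‖ := by ring

/-- Relational local fields of globally oriented frames are translation covariant. -/
lemma relField_eq (V : SystemRep s HS) (R : RelativisticQRF s HR) {ω : State HR}
    (hω : R.GloballyOriented ω) (φ : HS →L[ℂ] HS) (x : Mink s) :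
    relField V R ω φ x = V.T x * relField V R ω φ 0 * V.T (-x) := by
  -- Global orientation enters here: one measure serves all points, so a translation only conjugates
  -- the integrand.
  have hν : ∀ y, R.lorentzCond ω y = ((R.born ω) Set.univ)⁻¹ • (R.born ω).snd := fun y => by
    rw [RelativisticQRF.lorentzCond, if_pos hω]
  have hfin : IsFiniteMeasure (((R.born ω) Set.univ)⁻¹ • (R.born ω).snd) := by
    by_cases h0 : R.born ω = 0
    -- The frame observable need not be normalised. For zero Born measure the factor is ∞, and ∞
    -- times the zero measure is the zero measure.
    · rw [h0]; simp only [Measure.snd_zero, smul_zero]; infer_instance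
    · refine Measure.smul_finite _ (ENNReal.inv_ne_top.2 ?_)
      simpa using h0
  set ν := ((R.born ω) Set.univ)⁻¹ • (R.born ω).snd with hνdef
  obtain ⟨A, hA⟩ := exists_isWeakIntegral ν (fun l => V.act (0, l) φ) (fun ξ η =>
    ((V.continuous_conj φ ξ η).comp (Continuous.prodMk_right 0)).aestronglyMeasurable) ‖φ‖
    (fun l => V.norm_act_le _ _)
  have h0 : relField V R ω φ 0 = A := by
    rw [relField, hν]; exact hA.eq
  rw [h0, relField, hν]
  refine IsWeakIntegral.eq fun ξ η => ?_
  have e : ∀ B : HS →L[ℂ] HS, ⟪ξ, (V.T x * B * V.T (-x)) η⟫_ℂ =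
      ⟪V.T (-x) ξ, B (V.T (-x) η)⟫_ℂ := fun B => by
    rw [V.inner_T_left, neg_neg]; rfl
  simp_rw [V.act_eq x, V.star_T, e]
  exact hA _ _

end Fields

/-! ### Ordered products of operator families. -/

section Products

variable {H : Type*} [NormedAddCommGroup H] [InnerProductSpace ℂ H]

/-- Joint continuity in the parameter and the vector is the form of strong continuity that composes,
which makes the induction work. -/
lemma continuous_ofFn_prod_apply {X : Type*} [TopologicalSpace X] {n : ℕ}
    {F : Fin n → X → H →L[ℂ] H} (hF : ∀ j, Continuous fun p : X × H => F j p.1 p.2) :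
    Continuous fun p : X × H => (List.ofFn fun j => F j p.1).prod p.2 := by
  induction n with
  | zero => simpa using continuous_snd
  | succ n ih =>
    simp only [List.ofFn_succ, List.prod_cons]
    exact (hF 0).comp (continuous_fst.prodMk (ih fun j => hF j.succ))

lemma continuous_ofFn_prod_apply_const {X : Type*} [TopologicalSpace X] {n : ℕ}
    {F : Fin n → X → H →L[ℂ] H} (hF : ∀ j, Continuous fun p : X × H => F j p.1 p.2) (v : H) :
    Continuous fun x => (List.ofFn fun j => F j x).prod v :=
  (continuous_ofFn_prod_apply hF).comp (Continuous.prodMk_left v)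

lemma exists_norm_ofFn_prod_le {X : Type*} {n : ℕ} {F : Fin n → X → H →L[ℂ] H}
    (hF : ∀ j, ∃ C, ∀ x, ‖F j x‖ ≤ C) : ∃ C, ∀ x, ‖(List.ofFn fun j => F j x).prod‖ ≤ C := by
  induction n with
  | zero => exact ⟨1, fun x => by
    rw [List.ofFn_zero, List.prod_nil]
    exact ContinuousLinearMap.norm_id_le⟩
  | succ n ih =>
    obtain ⟨C, hC⟩ := ih fun j => hF j.succ
    obtain ⟨C₀, hC₀⟩ := hF 0
    refine ⟨C₀ * C, fun x => ?_⟩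
    simp only [List.ofFn_succ, List.prod_cons]
    exact (norm_mul_le _ _).trans (mul_le_mul (hC₀ x) (hC x) (norm_nonneg _)
      ((norm_nonneg _).trans (hC₀ x)))

/-- Isolates the place where a shift of one variable acts; A and B do not depend on X. -/
lemma exists_ofFn_prod_insert {M : Type*} [Monoid M] {n : ℕ} (a : Fin n → M) (j : Fin n) :
    ∃ A B, ∀ X, (List.ofFn fun k => if k = j then X * a k else a k).prod = A * X * B := by
  induction n with
  | zero => exact j.elim0
  | succ n ih =>
    simp only [List.ofFn_succ, List.prod_cons]
    refine Fin.cases ?_ (fun i => ?_) j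
    · exact ⟨1, a 0 * (List.ofFn fun k : Fin n => a k.succ).prod, fun X => by
        simp [Fin.succ_ne_zero, mul_assoc]⟩
    · obtain ⟨A, B, h⟩ := ih (fun k => a k.succ) i
      refine ⟨a 0 * A, B, fun X => ?_⟩
      simp only [Fin.succ_inj, h, (Fin.succ_ne_zero i).symm, if_false, mul_assoc]

end Products

/-! ### Both kernels as one function of position differences. -/

section Kernels

variable {s : ℕ} {H : Type*} [NormedAddCommGroup H] [InnerProductSpace ℂ H] [CompleteSpace H]
  (V : SystemRep s H)

/-- The operator `A₀ U(ξ₁)† A₁ ⋯ U(ξₙ)† Aₙ`. -/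
noncomputable def chain {n : ℕ} (A : Fin (n + 1) → H →L[ℂ] H) (ξ : Fin n → Mink s) : H →L[ℂ] H :=
  A 0 * (List.ofFn fun j : Fin n => V.T (-ξ j) * A j.succ).prod

/-- Split U(b)y = U(b)x + U(b)(y - x): the first term is continuous in b, and the second has norm ‖y
- x‖. -/
lemma SystemRep.continuous_T : Continuous fun p : Mink s × H => V.T p.1 p.2 := by
  rw [continuous_iff_continuousAt]
  rintro ⟨a, x⟩
  have h1 : Filter.Tendsto (fun p : Mink s × H => V.T p.1 x) (nhds (a, x)) (nhds (V.T a x)) :=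
    ((V.continuous_T_apply x).comp continuous_fst).tendsto (a, x)
  have h2 : Filter.Tendsto (fun p : Mink s × H => V.T p.1 (p.2 - x)) (nhds (a, x)) (nhds 0) := by
    rw [tendsto_zero_iff_norm_tendsto_zero]
    simp only [V.norm_T_apply]
    have h3 : Continuous fun p : Mink s × H => ‖p.2 - x‖ := by fun_prop
    simpa using h3.tendsto (a, x)
  have h4 := h1.add h2
  rw [add_zero] at h4
  refine h4.congr fun p => ?_
  rw [map_sub]; abel

lemma continuous_chain {n : ℕ} (A : Fin (n + 1) → H →L[ℂ] H) (x : H) :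
    Continuous fun ξ => chain V A ξ x := by
  have hF : ∀ j : Fin n, Continuous fun p : (Fin n → Mink s) × H =>
      (fun (j : Fin n) (ξ : Fin n → Mink s) => V.T (-ξ j) * A j.succ) j p.1 p.2 := fun j => by
    have hp : Continuous fun p : (Fin n → Mink s) × H => (-p.1 j, A j.succ p.2) := by fun_prop
    exact V.continuous_T.comp hp
  exact (A 0).continuous.comp (continuous_ofFn_prod_apply_const hF x)

lemma exists_norm_chain_le {n : ℕ} (A : Fin (n + 1) → H →L[ℂ] H) :
    ∃ C, ∀ ξ, ‖chain V A ξ‖ ≤ C := by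
  obtain ⟨C, hC⟩ := exists_norm_ofFn_prod_le (X := Fin n → Mink s) (n := n)
    (F := fun j ξ => V.T (-ξ j) * A j.succ) (fun j => ⟨‖A j.succ‖, fun ξ =>
      (norm_mul_le _ _).trans (mul_le_of_le_one_left (norm_nonneg _) (V.norm_T_le _))⟩)
  exact ⟨‖A 0‖ * C, fun ξ => (norm_mul_le _ _).trans
    (mul_le_mul_of_nonneg_left (hC ξ) (norm_nonneg _))⟩

/-- Only the factor U(ξⱼ)† changes, and it acquires U(η)† on its left. The dependence on one
variable is thus through a single translation, which spectral calculus can treat. -/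
lemma exists_chain_add_single {n : ℕ} (A : Fin (n + 1) → H →L[ℂ] H) (ξ : Fin n → Mink s)
    (j : Fin n) : ∃ B C : H →L[ℂ] H, ∀ η, chain V A (ξ + Pi.single j η) = B * V.T (-η) * C := by
  obtain ⟨B, C, h⟩ := exists_ofFn_prod_insert (fun k => V.T (-ξ k) * A k.succ) j
  refine ⟨A 0 * B, C, fun η => ?_⟩
  have := h (V.T (-η))
  rw [chain, mul_assoc, mul_assoc, ← mul_assoc B, ← this]
  congr 3
  funext k
  split_ifs with hk
  · subst hk
    simp [← mul_assoc, V.T_mul_T]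
  · simp [hk]

/-- Adjacent factors merge as U(xᵢ)† U(xᵢ₊₁) = U(xᵢ - xᵢ₊₁)†, leaving only the two outer
translations. -/
lemma ofFn_prod_conj_T {n : ℕ} (A : Fin (n + 1) → H →L[ℂ] H) (x : Fin (n + 1) → Mink s) :
    (List.ofFn fun i => V.T (x i) * A i * V.T (-x i)).prod =
      V.T (x 0) * chain V A (fun j => x j.castSucc - x j.succ) * V.T (-x (Fin.last n)) := by
  induction n with
  | zero => simp [chain]
  | succ n ih =>
    rw [List.ofFn_succ, List.prod_cons, ih (fun i => A i.succ) (fun i => x i.succ)]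
    simp only [chain, List.ofFn_succ (n := n), List.prod_cons, Fin.succ_last, Fin.castSucc_zero,
      Fin.succ_castSucc, neg_sub]
    have h : V.T (x (Fin.succ 0) - x 0) = V.T (-x 0) * V.T (x (Fin.succ 0)) := by
      rw [V.T_mul_T]; congr 1; abel
    rw [h]
    simp only [mul_assoc]

variable {Ω : State H}

/-- In the form ∑ ⟨√Ω e, B √Ω e⟩ of the trace, each translation reaches a vector √Ω e, directly or
through its adjoint, and fixes it. -/
lemma trace_mul_T_mul_T (hs : 1 ≤ s) (hΩ : V.IsInvariant Ω) (a b : Mink s) (B : H →L[ℂ] H) :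
    trace (Ω.1 * (V.T a * B * V.T b)) = trace (Ω.1 * B) := by
  have hT : ∀ c x, V.T c (CFC.sqrt Ω.1 x) = CFC.sqrt Ω.1 x := fun c x =>
    congrArg (fun A : H →L[ℂ] H => A x) (T_mul_sqrt V hs hΩ c)
  rw [← (Ω.2.hasSum_sqrt _).tsum_eq, ← (Ω.2.hasSum_sqrt B).tsum_eq]
  congr 1; funext i
  change ⟪_, V.T a (B (V.T b (CFC.sqrt Ω.1 (basis H i))))⟫_ℂ = _
  rw [hT, ← neg_neg a, ← V.inner_T_left, hT]

lemma continuous_trace_chain {n : ℕ} (A : Fin (n + 1) → H →L[ℂ] H) :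
    Continuous fun ξ => trace (Ω.1 * chain V A ξ) := by
  obtain ⟨C, hC⟩ := exists_norm_chain_le V A
  rw [continuous_iff_continuousAt]
  intro ξ
  exact tendsto_trace_density_mul Ω.2 hC fun x =>
    (continuous_const.inner (continuous_chain V A x)).tendsto ξ

lemma exists_norm_trace_chain_le {n : ℕ} (A : Fin (n + 1) → H →L[ℂ] H) :
    ∃ C, ∀ ξ, ‖trace (Ω.1 * chain V A ξ)‖ ≤ C := by
  obtain ⟨C, hC⟩ := exists_norm_chain_le V A
  exact ⟨C, fun ξ => (norm_trace_density_mul_le Ω.2 _).trans (hC ξ)⟩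

variable {HR : Type*} [NormedAddCommGroup HR] [InnerProductSpace ℂ HR] [CompleteSpace HR]

lemma vacuumKernel_eq (hs : 1 ≤ s) (hΩ : V.IsInvariant Ω) (R : RelativisticQRF s HR) {n : ℕ}
    {ω : Fin (n + 1) → State HR} (hω : ∀ i, R.GloballyOriented (ω i))
    (φ : Fin (n + 1) → H →L[ℂ] H) (x : Fin (n + 1) → Mink s) :
    vacuumKernel V R Ω ω φ x = trace (Ω.1 * chain V (fun i => relField V R (ω i) (φ i) 0)
      (fun j => x j.castSucc - x j.succ)) := by
  simp_rw [vacuumKernel, fun i => relField_eq V R (hω i) (φ i) (x i)]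
  rw [ofFn_prod_conj_T V (fun i => relField V R (ω i) (φ i) 0), trace_mul_T_mul_T V hs hΩ]

lemma differenceKernel_eq (hs : 1 ≤ s) (hΩ : V.IsInvariant Ω) (R : RelativisticQRF s HR) {n : ℕ}
    (ω : Fin (n + 1) → State HR) (φ : Fin (n + 1) → H →L[ℂ] H) (ξ : Fin n → Mink s) :
    differenceKernel V R Ω ω φ ξ =
      trace (Ω.1 * chain V (fun i => relField V R (ω i) (φ i) 0) ξ) := by
  have := trace_mul_T_mul_T V hs hΩ (∑ j, ξ j) 0 (chain V (fun i => relField V R (ω i) (φ i) 0) ξ)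
  rw [← this, differenceKernel, V.T_zero, mul_one, chain]
  simp only [V.star_T, mul_assoc]

end Kernels

/-! ### Fourier inversion with the Minkowski product. -/

section MinkowskiFourier

open FourierTransform

variable {s : ℕ}

/-- Reflection of the space coordinates. -/
noncomputable def spaceReflection (s : ℕ) : Mink s ≃ₗᵢ[ℝ] Mink s :=
  LinearIsometryEquiv.piLpCongrRight 2
    (Fin.cons (LinearIsometryEquiv.refl ℝ ℝ) fun _ => LinearIsometryEquiv.neg ℝ)

lemma mdot_eq_inner (p x : Mink s) : mdot p x = ⟪p, spaceReflection s x⟫_ℝ := by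
  simp [mdot, spaceReflection, PiLp.inner_apply, Fin.sum_univ_succ, mul_comm, sub_eq_add_neg]

lemma mdot_add_left (p q x : Mink s) : mdot (p + q) x = mdot p x + mdot q x := by
  simp [mdot_eq_inner, inner_add_left]

lemma mdot_add_right (p x y : Mink s) : mdot p (x + y) = mdot p x + mdot p y := by
  simp [mdot_eq_inner, inner_add_right]

lemma mdot_sub_left (p q x : Mink s) : mdot (p - q) x = mdot p x - mdot q x := by
  simp [mdot_eq_inner, inner_sub_left]

lemma mdot_sub_right (p x y : Mink s) : mdot p (x - y) = mdot p x - mdot p y := by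
  simp [mdot_eq_inner, inner_sub_right]

lemma mdot_smul_left (c : ℝ) (p x : Mink s) : mdot (c • p) x = c * mdot p x := by
  simp [mdot_eq_inner, real_inner_smul_left]

lemma mdot_smul_right (c : ℝ) (p x : Mink s) : mdot p (c • x) = c * mdot p x := by
  simp [mdot_eq_inner, real_inner_smul_right]

@[simp] lemma mdot_zero_right (x : Mink s) : mdot x 0 = 0 := by simp [mdot_eq_inner]

lemma continuous_mdot : Continuous fun p : Mink s × Mink s => mdot p.1 p.2 := by
  simp_rw [mdot_eq_inner]
  exact continuous_fst.inner ((spaceReflection s).continuous.comp continuous_snd)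

lemma norm_cexp_I_mul (t : ℝ) : ‖Complex.exp (Complex.I * t)‖ = 1 := by
  rw [mul_comm, Complex.norm_exp_ofReal_mul_I]

/-- The Fourier transform with Minkowski products in the exponent. -/
noncomputable def minkFT (f : Mink s → ℂ) (x : Mink s) : ℂ :=
  ∫ p, Complex.exp (Complex.I * (mdot p x : ℝ)) * f p

/-- `𝓕` has the phase exp(-2πi⟨p, w⟩) with the Euclidean product. Reflecting space and scaling by
-1/(2π) turns it into exp(i p · x). -/
lemma minkFT_eq_fourier (f : Mink s → ℂ) (x : Mink s) :
    minkFT f x = 𝓕 f ((-(2 * Real.pi)⁻¹ : ℝ) • spaceReflection s x) := by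
  rw [minkFT, Real.fourier_eq']
  refine integral_congr_ae (Filter.Eventually.of_forall fun p => ?_)
  simp only [smul_eq_mul, real_inner_smul_right, ← mdot_eq_inner]
  congr 2
  rw [mul_comm]
  congr 2
  have := Real.pi_ne_zero
  field_simp

/-- The equivalence that relates `minkFT` to the Euclidean Fourier transform. -/
noncomputable def fourierScaling (s : ℕ) : Mink s ≃L[ℝ] Mink s :=
  (spaceReflection s).toContinuousLinearEquiv.trans
    (ContinuousLinearEquiv.smulLeft (Units.mk0 (-(2 * Real.pi)⁻¹ : ℝ)
      (neg_ne_zero.2 (inv_ne_zero Real.two_pi_pos.ne'))))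

/-- The Fourier transform with Minkowski products on Schwartz space. -/
noncomputable def minkFTCLM (s : ℕ) : 𝓢(Mink s, ℂ) →L[ℂ] 𝓢(Mink s, ℂ) :=
  SchwartzMap.compCLMOfContinuousLinearEquiv ℂ (fourierScaling s) ∘L
    SchwartzMap.fourierTransformCLM ℂ

lemma minkFTCLM_apply (f : 𝓢(Mink s, ℂ)) (x : Mink s) : minkFTCLM s f x = minkFT f x := by
  rw [minkFT_eq_fourier]
  rfl

/-- Fourier inversion at the origin; the factor (2π)ᵈ is the Jacobian of the rescaling of the
argument. -/
lemma integral_minkFT {k : Mink s → ℂ} (hc : Continuous k) (hk : Integrable k)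
    (hF : Integrable (minkFT k)) : ∫ x, minkFT k x = (2 * Real.pi : ℂ) ^ (s + 1) * k 0 := by
  have h1 : ∀ g : Mink s → ℂ, ∫ x, g ((-(2 * Real.pi)⁻¹ : ℝ) • spaceReflection s x) =
      ((2 * Real.pi) ^ (s + 1) : ℝ) • ∫ x, g x := fun g => by
    rw [(spaceReflection s).measurePreserving.integral_comp
      (spaceReflection s).toHomeomorph.measurableEmbedding
      (fun x => g ((-(2 * Real.pi)⁻¹ : ℝ) • x)), Measure.integral_comp_smul]
    congr 1
    rw [finrank_euclideanSpace_fin, ← inv_pow, inv_neg, inv_inv, abs_pow, abs_neg,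
      abs_of_pos Real.two_pi_pos]
  have hF' : Integrable (𝓕 k) := by
    have h2 : Integrable (fun x => 𝓕 k ((-(2 * Real.pi)⁻¹ : ℝ) • x)) := by
      have h3 := (spaceReflection s).measurePreserving.integrable_comp_emb
        (spaceReflection s).toHomeomorph.measurableEmbedding
        (g := fun x => 𝓕 k ((-(2 * Real.pi)⁻¹ : ℝ) • x))
      rw [← h3]
      exact hF.congr (Filter.Eventually.of_forall fun x => minkFT_eq_fourier k x)
    exact (integrable_comp_smul_iff volume (𝓕 k)
      (neg_ne_zero.2 (inv_ne_zero Real.two_pi_pos.ne'))).1 h2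
  have h4 := congrFun (hc.fourierInv_fourier_eq hk hF') 0
  rw [Real.fourierInv_eq'] at h4
  simp only [inner_zero_right, mul_zero, Complex.ofReal_zero, zero_mul, Complex.exp_zero,
    one_smul] at h4
  simp_rw [minkFT_eq_fourier]
  rw [h1, h4, Complex.real_smul]
  push_cast
  rfl

lemma minkFT_translate (f : Mink s → ℂ) (q x : Mink s) :
    minkFT (fun p => f (p + q)) x = Complex.exp (-(Complex.I * (mdot q x : ℝ))) * minkFT f x := by
  rw [minkFT, minkFT, ← integral_const_mul, ← integral_add_right_eq_self
    (fun p => Complex.exp _ * (Complex.exp (Complex.I * (mdot p x : ℝ)) * f p)) q]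
  refine integral_congr_ae (Filter.Eventually.of_forall fun p => ?_)
  simp only
  rw [← mul_assoc, ← Complex.exp_add, mdot_add_left]
  congr 2
  push_cast; ring

lemma integral_minkFT_mul_exp (h : 𝓢(Mink s, ℂ)) (q : Mink s) :
    ∫ x, minkFT h x * Complex.exp (-(Complex.I * (mdot q x : ℝ))) =
      (2 * Real.pi : ℂ) ^ (s + 1) * h q := by
  have e : (fun p => h (p + q)) = SchwartzMap.compSubConstCLM ℂ (-q) h := by
    funext p; simp
  have h1 := integral_minkFT (k := fun p => h (p + q)) (by fun_prop)
    (by rw [e]; exact SchwartzMap.integrable _)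
    (by
      rw [e]
      refine (minkFTCLM s (SchwartzMap.compSubConstCLM ℂ (-q) h)).integrable.congr
        (Filter.Eventually.of_forall fun x => minkFTCLM_apply _ x))
  simp only [minkFT_translate, zero_add] at h1
  rw [← h1]
  congr 1; funext x; ring

lemma integrable_minkFT (h : 𝓢(Mink s, ℂ)) : Integrable (minkFT h) :=
  (minkFTCLM s h).integrable.congr (Filter.Eventually.of_forall fun x => minkFTCLM_apply _ x)

lemma continuous_minkFT (h : 𝓢(Mink s, ℂ)) : Continuous (minkFT h) :=
  (minkFTCLM s h).continuous.congr fun x => minkFTCLM_apply _ x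

/-- Multiplication by a Schwartz function of `π q` is a superposition of phases. -/
lemma integral_comp_mul {X : Type*} [MeasurableSpace X] {μ : Measure X} [SFinite μ]
    (h : 𝓢(Mink s, ℂ)) {f : X → ℂ} (hf : Integrable f μ) {π : X → Mink s} (hπ : Measurable π) :
    (2 * Real.pi : ℂ) ^ (s + 1) * ∫ q, h (π q) * f q ∂μ =
      ∫ η, minkFT h η * ∫ q, Complex.exp (-(Complex.I * (mdot (π q) η : ℝ))) * f q ∂μ := by
  have hm : Measurable fun z : Mink s × X =>
      Complex.exp (-(Complex.I * (mdot (π z.2) z.1 : ℝ))) := by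
    have h0 := continuous_mdot (s := s).measurable
    have h1 : Measurable fun z : Mink s × X => mdot (π z.2) z.1 :=
      h0.comp ((hπ.comp measurable_snd).prodMk measurable_fst)
    exact Complex.measurable_exp.comp ((Complex.measurable_ofReal.comp h1).const_mul _).neg
  -- The phase has modulus one, so the integrand is dominated by an integrable product and Fubini
  -- applies.
  have hi : Integrable (Function.uncurry fun η q =>
      minkFT h η * (Complex.exp (-(Complex.I * (mdot (π q) η : ℝ))) * f q))
      (volume.prod μ) := by
    have h1 := (integrable_minkFT h).mul_prod hf
    have h2 := h1.bdd_mul (c := 1) hm.aestronglyMeasurable (Filter.Eventually.of_forall fun z => by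
      rw [← mul_neg, ← Complex.ofReal_neg, norm_cexp_I_mul])
    refine h2.congr (Filter.Eventually.of_forall fun z => ?_)
    simp only [Function.uncurry]
    ring
  calc _ = ∫ q, (∫ η, minkFT h η * Complex.exp (-(Complex.I * (mdot (π q) η : ℝ)))) * f q ∂μ := by
        rw [← integral_const_mul]
        simp_rw [integral_minkFT_mul_exp]
        congr 1; funext q; ring
    _ = ∫ q, ∫ η : Mink s, minkFT h η * (Complex.exp (-(Complex.I * (mdot (π q) η : ℝ))) * f q) ∂volume ∂μ := by
        simp_rw [← integral_mul_const, mul_assoc]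
    _ = _ := by
        rw [← integral_integral_swap hi]
        simp_rw [integral_const_mul]

end MinkowskiFourier

/-! ### Fourier transforms in several Minkowski variables. -/

section ProductFourier

open FourierTransform

variable {s n : ℕ}

instance : (volume : Measure (Fin n → Mink s)).IsAddHaarMeasure :=
  inferInstanceAs (Measure.pi fun _ : Fin n => (volume : Measure (Mink s))).IsAddHaarMeasure

/-- The Fourier transform of functions of several Minkowski vectors. -/
noncomputable def prodFT (f : (Fin n → Mink s) → ℂ) (x : Fin n → Mink s) : ℂ :=
  ∫ p : Fin n → Mink s, Complex.exp (Complex.I * ((∑ j, mdot (p j) (x j) : ℝ) : ℂ)) * f p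

/-- `Fin n → Mink s` carries the sup norm, while `𝓕` needs an inner product, hence the detour
through `PiLp 2`. The two volumes agree up to a Haar constant, whose value is irrelevant to the
continuity on Schwartz space derived from this. -/
lemma exists_prodFT_eq_fourier (s n : ℕ) : ∃ c : ℂ, ∀ (f : (Fin n → Mink s) → ℂ) x,
    prodFT f x = c * 𝓕 (fun w : PiLp 2 (fun _ : Fin n => Mink s) => f w.ofLp)
      (WithLp.toLp 2 fun j => fourierScaling s (x j)) := by
  let e : PiLp 2 (fun _ : Fin n => Mink s) ≃L[ℝ] (Fin n → Mink s) :=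
    PiLp.continuousLinearEquiv 2 ℝ _
  have he : MeasurableEmbedding e := e.toHomeomorph.measurableEmbedding
  have hμ : (volume.map e).IsAddHaarMeasure := e.isAddHaarMeasure_map _
  obtain ⟨c, hc⟩ : ∃ c : NNReal, (volume : Measure (Fin n → Mink s)) = c • volume.map e :=
    ⟨_, Measure.isAddLeftInvariant_eq_smul _ _⟩
  refine ⟨((c : ℝ) : ℂ), fun f x => ?_⟩
  rw [prodFT, hc, integral_smul_nnreal_measure,
    he.integral_map, Real.fourier_eq', NNReal.smul_def,
    Complex.real_smul]
  congr 1
  refine integral_congr_ae (Filter.Eventually.of_forall fun w => ?_)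
  change Complex.exp (Complex.I * ((∑ j, mdot (w.ofLp j) (x j) : ℝ) : ℂ)) * f w.ofLp = _
  simp only [smul_eq_mul, PiLp.inner_apply]
  congr 2
  rw [mul_comm, Finset.mul_sum]
  congr 2
  refine Finset.sum_congr rfl fun j _ => ?_
  change _ = -2 * Real.pi * ⟪w.ofLp j, (-(2 * Real.pi)⁻¹ : ℝ) • spaceReflection s (x j)⟫_ℝ
  rw [real_inner_smul_right, ← mdot_eq_inner]
  have := Real.pi_ne_zero
  field_simp

lemma exists_prodFTCLM (s n : ℕ) : ∃ F : 𝓢(Fin n → Mink s, ℂ) →L[ℂ] 𝓢(Fin n → Mink s, ℂ),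
    ∀ f x, F f x = prodFT f x := by
  obtain ⟨c, hc⟩ := exists_prodFT_eq_fourier s n
  let e : PiLp 2 (fun _ : Fin n => Mink s) ≃L[ℝ] (Fin n → Mink s) :=
    PiLp.continuousLinearEquiv 2 ℝ _
  let g : (Fin n → Mink s) ≃L[ℝ] PiLp 2 (fun _ : Fin n => Mink s) :=
    (ContinuousLinearEquiv.piCongrRight fun _ : Fin n => fourierScaling s).trans e.symm
  refine ⟨c • (SchwartzMap.compCLMOfContinuousLinearEquiv ℂ g ∘L
    SchwartzMap.fourierTransformCLM ℂ ∘L SchwartzMap.compCLMOfContinuousLinearEquiv ℂ e),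
    fun f x => ?_⟩
  rw [hc]
  rfl

/-- The Fourier transform of functions of several Minkowski vectors, on Schwartz space. -/
noncomputable def prodFTCLM (s n : ℕ) : 𝓢(Fin n → Mink s, ℂ) →L[ℂ] 𝓢(Fin n → Mink s, ℂ) :=
  (exists_prodFTCLM s n).choose

lemma prodFTCLM_apply (f : 𝓢(Fin n → Mink s, ℂ)) (x : Fin n → Mink s) :
    prodFTCLM s n f x = prodFT f x := (exists_prodFTCLM s n).choose_spec f x

lemma integrable_prodFT (f : 𝓢(Fin n → Mink s, ℂ)) : Integrable (prodFT f) :=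
  (prodFTCLM s n f).integrable.congr (Filter.Eventually.of_forall fun x => prodFTCLM_apply f x)

lemma continuous_prodFT (f : 𝓢(Fin n → Mink s, ℂ)) : Continuous (prodFT f) :=
  (prodFTCLM s n f).continuous.congr fun x => prodFTCLM_apply f x

/-- Bounded continuous functions have a Fourier transform. -/
lemma exists_isFourierTransform {g : (Fin n → Mink s) → ℂ} (hg : Continuous g) {C : ℝ}
    (hC : ∀ x, ‖g x‖ ≤ C) : ∃ T, IsFourierTransform g T := by
  have hL : MemLp g ⊤ := memLp_top_of_bound hg.aestronglyMeasurable C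
    (Filter.Eventually.of_forall hC)
  -- The distribution f ↦ ∫ g f of the bounded function g, composed with the Fourier transform of
  -- test functions.
  refine ⟨PointwiseConvergenceCLM.precomp ℂ (prodFTCLM s n)
    (Lp.toTemperedDistribution (hL.toLp g)), fun f => ⟨?_, ?_⟩⟩
  · exact (integrable_prodFT f).bdd_mul (c := C) hg.aestronglyMeasurable
      (Filter.Eventually.of_forall hC)
  · change Lp.toTemperedDistribution (hL.toLp g) (prodFTCLM s n f) = _
    rw [Lp.toTemperedDistribution_apply]
    refine integral_congr_ae ?_
    filter_upwards [hL.coeFn_toLp] with x hx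
    rw [hx, prodFTCLM_apply, smul_eq_mul, mul_comm]
    rfl

end ProductFourier

lemma exists_norm_schwartz_le {E : Type*} [NormedAddCommGroup E] [NormedSpace ℝ E]
    (f : 𝓢(E, ℂ)) (k : ℕ) : ∃ C, 0 ≤ C ∧ ∀ x, ‖f x‖ ≤ C * (1 + ‖x‖) ^ (-(k : ℝ)) := by
  refine ⟨2 ^ k * (Finset.Iic (k, 0)).sup (fun m => SchwartzMap.seminorm ℂ m.1 m.2) f,
    by positivity, fun x => ?_⟩
  have h := SchwartzMap.one_add_le_sup_seminorm_apply (𝕜 := ℂ) (m := (k, 0)) (k := k) (n := 0)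
    le_rfl le_rfl f x
  rw [norm_iteratedFDeriv_zero] at h
  have hpos : 0 < 1 + ‖x‖ := by positivity
  rw [Real.rpow_neg hpos.le, Real.rpow_natCast, ← div_eq_mul_inv, le_div_iff₀ (by positivity),
    mul_comm]
  exact h

/-! ### Differences and partial sums as transposed, volume-preserving maps. -/

section Differences

variable {s : ℕ}

/-- Successive differences `R₀, R₁ - R₀, …`. -/
noncomputable def backwardDiff (s n : ℕ) :
    (Fin (n + 1) → Mink s) →ₗ[ℝ] (Fin (n + 1) → Mink s) where
  toFun R := fun k => R k - (Fin.cons (α := fun _ => Mink s) 0 (fun j => R j.castSucc) :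
    Fin (n + 1) → Mink s) k
  map_add' R R' := by
    funext k
    refine Fin.cases (by simp) (fun j => ?_) k
    simp only [Fin.cons_succ, Pi.add_apply]; abel
  map_smul' c R := by
    funext k
    refine Fin.cases (by simp) (fun j => ?_) k
    simp [smul_sub]

/-- Successive differences `x₀ - x₁, …, xₙ₋₁ - xₙ, xₙ`. -/
def forwardDiff {n : ℕ} (x : Fin (n + 1) → Mink s) : Fin (n + 1) → Mink s :=
  fun k => x k - (Fin.snoc (α := fun _ => Mink s) (fun j : Fin n => x j.succ) 0 :
    Fin (n + 1) → Mink s) k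

lemma backwardDiff_zero {n : ℕ} (R : Fin (n + 1) → Mink s) : backwardDiff s n R 0 = R 0 := by
  simp [backwardDiff]

lemma backwardDiff_succ {n : ℕ} (R : Fin (n + 1) → Mink s) (j : Fin n) :
    backwardDiff s n R j.succ = R j.succ - R j.castSucc := by
  simp [backwardDiff]

lemma forwardDiff_castSucc {n : ℕ} (x : Fin (n + 1) → Mink s) (j : Fin n) :
    forwardDiff x j.castSucc = x j.castSucc - x j.succ := by
  simp [forwardDiff]

lemma forwardDiff_last {n : ℕ} (x : Fin (n + 1) → Mink s) :
    forwardDiff x (Fin.last n) = x (Fin.last n) := by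
  simp [forwardDiff]

lemma backwardDiff_injective (s n : ℕ) : Function.Injective (backwardDiff s n) := by
  rw [← LinearMap.ker_eq_bot, LinearMap.ker_eq_bot']
  intro R hR
  have h : ∀ k : Fin (n + 1), R k = 0 := by
    intro k
    induction k using Fin.induction with
    | zero => rw [← backwardDiff_zero R, hR]; rfl
    | succ j ih =>
      have h1 := backwardDiff_succ R j
      rw [hR, ih, Pi.zero_apply, sub_zero] at h1
      exact h1.symm
  exact funext h

/-- In the coordinates (q₁, …, qₙ, P) of partial sums, `backwardDiff` recovers the individual
momenta; the slice P = 0 is the one picked out by the delta function. -/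
lemma momenta_eq_backwardDiff {n : ℕ} (q : Fin n → Mink s) :
    momenta s n q = backwardDiff s n (Fin.snoc (α := fun _ => Mink s) q 0) := by
  funext k
  simp [momenta, backwardDiff]

/-- Summation by parts. -/
lemma sum_mdot_backwardDiff {n : ℕ} (R x : Fin (n + 1) → Mink s) :
    ∑ k, mdot (backwardDiff s n R k) (x k) = ∑ k, mdot (R k) (forwardDiff x k) := by
  rw [Fin.sum_univ_succ, Fin.sum_univ_castSucc (fun k => mdot (R k) (forwardDiff x k))]
  simp only [backwardDiff_zero, backwardDiff_succ, forwardDiff_castSucc, forwardDiff_last,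
    mdot_sub_left, mdot_sub_right, Finset.sum_sub_distrib]
  have h1 := Fin.sum_univ_succ fun k => mdot (R k) (x k)
  have h2 := Fin.sum_univ_castSucc fun k => mdot (R k) (x k)
  linarith

lemma continuous_backwardDiff (s n : ℕ) : Continuous (backwardDiff s n) :=
  LinearMap.continuous_of_finiteDimensional _

/-- With R₀ split off, the tail undergoes the same map with fewer variables and then a translation
by -R₀ of its first entry: a skew product of volume-preserving maps. -/
lemma measurePreserving_backwardDiff (s n : ℕ) : MeasurePreserving (backwardDiff s n) := by
  induction n with
  | zero =>
    convert MeasurePreserving.id _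
    funext R k
    rw [Fin.fin_one_eq_zero k, backwardDiff_zero]; rfl
  | succ n ih =>
    let e := MeasurableEquiv.piFinSuccAbove (fun _ : Fin (n + 2) => Mink s) 0
    have he : MeasurePreserving e := volume_preserving_piFinSuccAbove (fun _ => Mink s) 0
    have hsk : MeasurePreserving (fun p : Mink s × (Fin (n + 1) → Mink s) =>
        (p.1, backwardDiff s n p.2 + Pi.single 0 (-p.1))) :=
      (MeasurePreserving.id volume).skew_product
        (g := fun a R => backwardDiff s n R + Pi.single 0 (-a))
        (((continuous_backwardDiff s n).comp continuous_snd).add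
          ((continuous_single 0).comp continuous_fst.neg)).measurable
        (Filter.Eventually.of_forall fun a =>
          ((measurePreserving_add_right volume (Pi.single 0 (-a))).comp ih).map_eq)
    convert (he.symm e).comp (hsk.comp he) using 1
    funext R
    rw [Function.comp_apply, Function.comp_apply, MeasurableEquiv.eq_symm_apply]
    refine Prod.ext (backwardDiff_zero R) ?_
    funext j
    refine Fin.cases ?_ (fun i => ?_) j
    · change backwardDiff s (n + 1) R (Fin.succ 0) = backwardDiff s n (fun j => R j.succ) 0 + _
      rw [backwardDiff_succ, backwardDiff_zero, Pi.single_eq_same, sub_eq_add_neg]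
      rfl
    · change backwardDiff s (n + 1) R i.succ.succ =
        backwardDiff s n (fun j => R j.succ) i.succ + _
      rw [backwardDiff_succ, backwardDiff_succ, Pi.single_eq_of_ne (Fin.succ_ne_zero i), add_zero]
      rfl

/-- Here the head x₀ is translated by an amount that depends on the tail, so the tail is the base of
the skew product and swaps are needed on both sides. -/
lemma measurePreserving_forwardDiff (s n : ℕ) :
    MeasurePreserving (forwardDiff : (Fin (n + 1) → Mink s) → _) := by
  induction n with
  | zero =>
    convert MeasurePreserving.id _
    funext x k
    rw [show k = Fin.last 0 from Fin.fin_one_eq_zero k, forwardDiff_last]; rfl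
  | succ n ih =>
    let e := MeasurableEquiv.piFinSuccAbove (fun _ : Fin (n + 2) => Mink s) 0
    have he : MeasurePreserving e := volume_preserving_piFinSuccAbove (fun _ => Mink s) 0
    have hsk : MeasurePreserving (fun p : (Fin (n + 1) → Mink s) × Mink s =>
        (forwardDiff p.1, p.2 + -p.1 0)) :=
      ih.skew_product (g := fun R a => a + -R 0)
        (continuous_snd.add ((continuous_apply 0).comp continuous_fst).neg).measurable
        (Filter.Eventually.of_forall fun R =>
          (measurePreserving_add_right volume (-R 0)).map_eq)
    have hsw : ∀ {α β : Type} [MeasureSpace α] [MeasureSpace β]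
        [SFinite (volume : Measure α)] [SFinite (volume : Measure β)],
        MeasurePreserving (Prod.swap : α × β → β × α) := Measure.measurePreserving_swap
    convert (he.symm e).comp (hsw.comp (hsk.comp (hsw.comp he))) using 1
    funext x
    simp only [Function.comp_apply]
    rw [MeasurableEquiv.eq_symm_apply]
    refine Prod.ext ?_ ?_
    · change forwardDiff x (Fin.castSucc 0) = x 0 + -x (Fin.succ 0)
      rw [forwardDiff_castSucc, sub_eq_add_neg]; rfl
    · funext j
      change forwardDiff x j.succ = forwardDiff (fun k : Fin (n + 1) => x k.succ) j
      refine Fin.lastCases ?_ (fun i => ?_) j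
      · rw [Fin.succ_last, forwardDiff_last, forwardDiff_last]; rfl
      · rw [forwardDiff_castSucc, Fin.succ_castSucc]
        exact forwardDiff_castSucc x i.succ

lemma integral_comp_of_measurePreserving {X Y : Type*} [MeasurableSpace X] [MeasurableSpace Y]
    {μ : Measure X} {ν : Measure Y} {g : X → Y} (hg : MeasurePreserving g μ ν) {f : Y → ℂ}
    (hf : AEStronglyMeasurable f ν) : ∫ x, f (g x) ∂μ = ∫ y, f y ∂ν := by
  rw [← hg.map_eq] at hf ⊢
  exact (integral_map hg.measurable.aemeasurable hf).symm

/-- Pullback of test functions by `backwardDiff`. -/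
noncomputable def backwardDiffCLM (s n : ℕ) :
    𝓢(Fin (n + 1) → Mink s, ℂ) →L[ℂ] 𝓢(Fin (n + 1) → Mink s, ℂ) :=
  SchwartzMap.compCLMOfContinuousLinearEquiv ℂ
    (LinearEquiv.ofInjectiveEndo _ (backwardDiff_injective s n)).toContinuousLinearEquiv

lemma backwardDiffCLM_apply {n : ℕ} (f : 𝓢(Fin (n + 1) → Mink s, ℂ)) (R : Fin (n + 1) → Mink s) :
    backwardDiffCLM s n f R = f (backwardDiff s n R) := rfl

lemma continuous_phase {n : ℕ} : Continuous fun p : (Fin n → Mink s) × (Fin n → Mink s) =>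
    Complex.exp (Complex.I * ((∑ j, mdot (p.1 j) (p.2 j) : ℝ) : ℂ)) := by
  have h : Continuous fun p : (Fin n → Mink s) × (Fin n → Mink s) => ∑ j, mdot (p.1 j) (p.2 j) :=
    continuous_finsetSum _ fun j _ => by
      have hj : Continuous fun p : (Fin n → Mink s) × (Fin n → Mink s) => (p.1 j, p.2 j) := by
        fun_prop
      exact continuous_mdot.comp hj
  exact Complex.continuous_exp.comp (continuous_const.mul (Complex.continuous_ofReal.comp h))

lemma prodFT_eq_forwardDiff {n : ℕ} (f : 𝓢(Fin (n + 1) → Mink s, ℂ)) (x : Fin (n + 1) → Mink s) :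
    prodFT f x = prodFT (backwardDiffCLM s n f) (forwardDiff x) := by
  have hc : Continuous fun p => Complex.exp (Complex.I * ((∑ j, mdot (p j) (x j) : ℝ) : ℂ)) * f p :=
    (continuous_phase.comp (continuous_id.prodMk continuous_const)).mul f.continuous
  rw [prodFT, ← integral_comp_of_measurePreserving (measurePreserving_backwardDiff s n)
    hc.aestronglyMeasurable, prodFT]
  simp only [sum_mdot_backwardDiff, backwardDiffCLM_apply]

end Differences

/-! ### The delta function of total momentum. -/

section Delta

variable {s n : ℕ}

lemma continuous_snoc : Continuous fun p : Mink s × (Fin n → Mink s) =>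
    (Fin.snoc (α := fun _ => Mink s) p.2 p.1 : Fin (n + 1) → Mink s) := by
  refine continuous_pi fun k => ?_
  refine Fin.lastCases ?_ (fun j => ?_) k
  · simp only [Fin.snoc_last]; fun_prop
  · simp only [Fin.snoc_castSucc]; fun_prop

lemma measurePreserving_snoc (s n : ℕ) : MeasurePreserving fun p : Mink s × (Fin n → Mink s) =>
    (Fin.snoc (α := fun _ => Mink s) p.2 p.1 : Fin (n + 1) → Mink s) := by
  have h := (volume_preserving_piFinSuccAbove (fun _ : Fin (n + 1) => Mink s) (Fin.last n)).symm
  have e : ((MeasurableEquiv.piFinSuccAbove (fun _ : Fin (n + 1) => Mink s) (Fin.last n)).symm :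
      Mink s × (Fin n → Mink s) → _) = fun p => Fin.snoc (α := fun _ => Mink s) p.2 p.1 := by
    funext p
    rw [← Fin.insertNth_last']
    rfl
  rwa [e] at h

lemma integrable_snoc {f : (Fin (n + 1) → Mink s) → ℂ} (hf : Integrable f) :
    Integrable fun p : Mink s × (Fin n → Mink s) =>
      f (Fin.snoc (α := fun _ => Mink s) p.2 p.1) :=
  (measurePreserving_snoc s n).integrable_comp_of_integrable hf

lemma prodFT_snoc (f : 𝓢(Fin (n + 1) → Mink s, ℂ)) (ξ : Fin n → Mink s) (y : Mink s) :
    prodFT f (Fin.snoc (α := fun _ => Mink s) ξ y) =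
      minkFT (fun P => prodFT (fun q => f (Fin.snoc (α := fun _ => Mink s) q P)) ξ) y := by
  have hc : Continuous fun p => Complex.exp (Complex.I * ((∑ j, mdot (p j)
      ((Fin.snoc (α := fun _ => Mink s) ξ y : Fin (n + 1) → Mink s) j) : ℝ) : ℂ)) * f p :=
    (continuous_phase.comp (continuous_id.prodMk continuous_const)).mul f.continuous
  have hi : Integrable fun p => Complex.exp (Complex.I * ((∑ j, mdot (p j)
      ((Fin.snoc (α := fun _ => Mink s) ξ y : Fin (n + 1) → Mink s) j) : ℝ) : ℂ)) * f p :=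
    f.integrable.bdd_mul (c := 1)
      (continuous_phase.comp (continuous_id.prodMk continuous_const)).aestronglyMeasurable
      (Filter.Eventually.of_forall fun p => (norm_cexp_I_mul _).le)
  rw [prodFT, ← integral_comp_of_measurePreserving (measurePreserving_snoc s n)
    hc.aestronglyMeasurable]
  rw [Measure.volume_eq_prod, integral_prod _ (integrable_snoc hi)]
  simp only [minkFT, prodFT, ← integral_const_mul]
  congr 1; funext P; congr 1; funext q
  simp only [Fin.sum_univ_castSucc, Fin.snoc_castSucc, Fin.snoc_last]
  rw [← mul_assoc, ← Complex.exp_add]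
  congr 2
  push_cast; ring

/-- With `integrable_prodFT_snoc`, this supplies the hypotheses of Fourier inversion in P. The decay
of f in q alone, uniform in P, dominates. -/
lemma continuous_prodFT_snoc (f : 𝓢(Fin (n + 1) → Mink s, ℂ)) (ξ : Fin n → Mink s) :
    Continuous fun P => prodFT (fun q => f (Fin.snoc (α := fun _ => Mink s) q P)) ξ := by
  obtain ⟨C, hC0, hC⟩ := exists_norm_schwartz_le f
    (volume : Measure (Fin n → Mink s)).integrablePower
  have hb := (Measure.integrable_pow_neg_integrablePower
    (volume : Measure (Fin n → Mink s))).const_mul C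
  refine continuous_of_dominated (fun P => ?_) (fun P => Filter.Eventually.of_forall fun q => ?_)
    hb (Filter.Eventually.of_forall fun q => ?_)
  · exact ((continuous_phase.comp (continuous_id.prodMk continuous_const)).mul
      (f.continuous.comp (continuous_snoc.comp
        (continuous_const.prodMk continuous_id)))).aestronglyMeasurable
  · rw [norm_mul, norm_cexp_I_mul, one_mul]
    refine (hC _).trans (mul_le_mul_of_nonneg_left ?_ hC0)
    refine Real.rpow_le_rpow_of_nonpos (by positivity) ?_ (by simp)
    gcongr
    refine (pi_norm_le_iff_of_nonneg (norm_nonneg _)).2 fun j => ?_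
    refine le_trans (le_of_eq ?_) (norm_le_pi_norm _ j.castSucc)
    rw [Fin.snoc_castSucc]
  · exact continuous_const.mul (f.continuous.comp (continuous_snoc.comp
        (continuous_id.prodMk continuous_const)))

lemma integrable_prodFT_snoc (f : 𝓢(Fin (n + 1) → Mink s, ℂ)) (ξ : Fin n → Mink s) :
    Integrable fun P => prodFT (fun q => f (Fin.snoc (α := fun _ => Mink s) q P)) ξ := by
  have hm : Continuous fun p : Mink s × (Fin n → Mink s) =>
      Complex.exp (Complex.I * ((∑ j, mdot (p.2 j) (ξ j) : ℝ) : ℂ)) :=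
    continuous_phase.comp (continuous_snd.prodMk continuous_const)
  have h := (integrable_snoc f.integrable).bdd_mul (c := 1) hm.aestronglyMeasurable
    (Filter.Eventually.of_forall fun p => (norm_cexp_I_mul _).le)
  rw [Measure.volume_eq_prod] at h
  exact h.integral_prod_left

/-- A function of the differences of its arguments has a Fourier transform supported on total
momentum zero. -/
lemma integral_mul_prodFT_of_differences {g : (Fin n → Mink s) → ℂ} (hg : Continuous g) {C : ℝ}
    (hC : ∀ ξ, ‖g ξ‖ ≤ C) (f : 𝓢(Fin (n + 1) → Mink s, ℂ)) :
    ∫ x : Fin (n + 1) → Mink s, g (fun j => x j.castSucc - x j.succ) * prodFT f x =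
      (2 * Real.pi : ℂ) ^ (s + 1) * ∫ ξ, g ξ * prodFT (fun q => f (momenta s n q)) ξ := by
  -- F is the test function in partial-sum coordinates, with P as the last one.
  set F := backwardDiffCLM s n f with hF
  let G : (Fin (n + 1) → Mink s) → ℂ := fun z => g (fun j => z j.castSucc) * prodFT F z
  have hgc : Continuous fun z : Fin (n + 1) → Mink s => g (fun j => z j.castSucc) :=
    hg.comp (by fun_prop)
  have hGc : Continuous G := hgc.mul (continuous_prodFT F)
  have hGi : Integrable G := (integrable_prodFT F).bdd_mul (c := C) hgc.aestronglyMeasurable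
    (Filter.Eventually.of_forall fun z => hC _)
  have h1 : ∫ x : Fin (n + 1) → Mink s, g (fun j => x j.castSucc - x j.succ) * prodFT f x =
      ∫ z, G z := by
    rw [← integral_comp_of_measurePreserving (measurePreserving_forwardDiff s n)
      hGc.aestronglyMeasurable]
    simp only [G, forwardDiff_castSucc, prodFT_eq_forwardDiff f, hF]
  rw [h1, ← integral_comp_of_measurePreserving (measurePreserving_snoc s n)
    hGc.aestronglyMeasurable, Measure.volume_eq_prod, integral_prod_symm _ (integrable_snoc hGi),
    ← integral_const_mul]
  have h2 := integrable_snoc (integrable_prodFT F)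
  rw [Measure.volume_eq_prod] at h2
  refine integral_congr_ae ?_
  -- Inversion in the last variable needs an integrable slice, which Fubini provides for almost
  -- every ξ.
  filter_upwards [h2.prod_left_ae] with ξ hξ
  simp only [G, Fin.snoc_castSucc, prodFT_snoc] at hξ ⊢
  -- g does not involve the last position y. Integrating over y evaluates at P = 0 and yields (2π)ᵈ.
  rw [integral_const_mul, integral_minkFT (continuous_prodFT_snoc F ξ)
    (integrable_prodFT_snoc F ξ) hξ]
  simp only [momenta_eq_backwardDiff, hF, backwardDiffCLM_apply]
  ring

end Delta

/-! ### Convolution against vector-valued functions. -/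

section Convolution

variable {s : ℕ}

/-- Fubini's theorem for the pairing of a convolution along `ι` with a bounded function. -/
lemma integral_convolution_smul {E Y : Type*} [NormedAddCommGroup E] [MeasurableSpace E]
    [BorelSpace E] [SecondCountableTopology E] {μ : Measure E} [SFinite μ]
    [μ.IsAddRightInvariant] [NormedAddCommGroup Y] [NormedSpace ℂ Y]
    {ι : Mink s → E} (hι : Continuous ι) {k : Mink s → ℂ} (hk : Integrable k) {F : E → ℂ}
    (hF : Integrable F μ) {G : E → Y} (hG : Continuous G) {C : ℝ} (hC : ∀ ξ, ‖G ξ‖ ≤ C) :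
    ∫ ξ, (∫ η, k η * F (ξ - ι η)) • G ξ ∂μ = ∫ η, k η • ∫ ξ, F ξ • G (ξ + ι η) ∂μ := by
  -- In an incomplete space Bochner integrals are zero by convention, so both sides vanish.
  by_cases hY : CompleteSpace Y
  swap; · simp [integral, hY]
  -- The shear preserves the product measure, so the convolution integrand is jointly integrable.
  have hsk : MeasurePreserving (fun p : Mink s × E => (p.1, p.2 + -ι p.1)) (volume.prod μ)
      (volume.prod μ) :=
    (MeasurePreserving.id volume).skew_product (g := fun η ξ => ξ + -ι η)
      (continuous_snd.add (hι.comp continuous_fst).neg).measurable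
      (Filter.Eventually.of_forall fun η => (measurePreserving_add_right μ (-ι η)).map_eq)
  have h1 : Integrable (fun p : Mink s × E => k p.1 * F (p.2 + -ι p.1)) (volume.prod μ) :=
    hsk.integrable_comp_of_integrable (hk.mul_prod hF)
  have h2 : Integrable (Function.uncurry fun η ξ => (k η * F (ξ - ι η)) • G ξ)
      (volume.prod μ) := by
    refine (h1.norm.mul_const C).mono' ?_ (Filter.Eventually.of_forall fun p => ?_)
    · simp only [← sub_eq_add_neg] at h1
      exact h1.aestronglyMeasurable.smul (hG.comp continuous_snd).aestronglyMeasurable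
    · simp only [Function.uncurry, norm_smul, ← sub_eq_add_neg]
      exact mul_le_mul_of_nonneg_left (hC _) (norm_nonneg _)
  calc _ = ∫ ξ, ∫ η, (k η * F (ξ - ι η)) • G ξ ∂volume ∂μ := by simp_rw [integral_smul_const]
    _ = ∫ η, ∫ ξ, (k η * F (ξ - ι η)) • G ξ ∂μ := (integral_integral_swap h2).symm
    _ = _ := by
      congr 1; funext η
      simp_rw [mul_smul]
      rw [integral_smul]
      congr 1
      rw [← integral_add_right_eq_self (fun ξ => F (ξ - ι η) • G ξ) (ι η)]
      simp only [add_sub_cancel_right]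

end Convolution

/-! ### Multipliers, dilations and the convolution theorem. -/

section Multipliers

variable {s : ℕ}

/-- The function `p ↦ p · a`, as a continuous linear map. -/
noncomputable def mdotCLM (a : Mink s) : Mink s →L[ℝ] ℂ :=
  Complex.ofRealCLM ∘L innerSL ℝ (spaceReflection s a)

lemma mdotCLM_apply (a p : Mink s) : mdotCLM a p = (mdot p a : ℝ) := by
  rw [mdot_eq_inner, real_inner_comm]; rfl

/-- The product of a test function with `p ↦ p · a`. -/
noncomputable def mulMdot (a : Mink s) (h : 𝓢(Mink s, ℂ)) : 𝓢(Mink s, ℂ) :=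
  SchwartzMap.smulLeftCLM ℂ (mdotCLM a) h

lemma mulMdot_apply (a : Mink s) (h : 𝓢(Mink s, ℂ)) (p : Mink s) :
    mulMdot a h p = (mdot p a : ℝ) * h p := by
  rw [mulMdot, SchwartzMap.smulLeftCLM_apply_apply (mdotCLM a).hasTemperateGrowth,
    mdotCLM_apply, smul_eq_mul]

lemma hasDerivAt_minkFT (h : 𝓢(Mink s, ℂ)) (x a : Mink s) (t : ℝ) :
    HasDerivAt (fun t : ℝ => minkFT h (x + t • a))
      (Complex.I * minkFT (mulMdot a h) (x + t • a)) t := by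
  have hph : ∀ (f : 𝓢(Mink s, ℂ)) (t : ℝ), Continuous fun p =>
      Complex.exp (Complex.I * (mdot p (x + t • a) : ℝ)) * f p := fun f t => by
    have h1 : Continuous fun p : Mink s => mdot p (x + t • a) :=
      continuous_mdot.comp (continuous_id.prodMk continuous_const)
    exact (Complex.continuous_exp.comp (continuous_const.mul
      (Complex.continuous_ofReal.comp h1))).mul f.continuous
  have key := hasDerivAt_integral_of_dominated_loc_of_deriv_le (μ := (volume : Measure (Mink s)))
    (F := fun (t : ℝ) p => Complex.exp (Complex.I * (mdot p (x + t • a) : ℝ)) * h p)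
    (F' := fun (t : ℝ) p => Complex.I *
      (Complex.exp (Complex.I * (mdot p (x + t • a) : ℝ)) * mulMdot a h p))
    (x₀ := t) (s := Set.univ) (bound := fun p => ‖mulMdot a h p‖) Filter.univ_mem
    (Filter.Eventually.of_forall fun t => (hph h t).aestronglyMeasurable)
    (((h.integrable (μ := volume)).norm).mono' (hph h t).aestronglyMeasurable
      (Filter.Eventually.of_forall fun p => by rw [norm_mul, norm_cexp_I_mul, one_mul]))
    (continuous_const.mul (hph _ t)).aestronglyMeasurable
    (Filter.Eventually.of_forall fun p t _ => by
      rw [norm_mul, norm_mul, norm_cexp_I_mul, Complex.norm_I, one_mul, one_mul])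
    (SchwartzMap.integrable _).norm
    (Filter.Eventually.of_forall fun p t _ => ?_)
  · have h2 := key.2
    rw [integral_const_mul] at h2
    exact h2
  · have h3 : HasDerivAt (fun t : ℝ => Complex.I * ((mdot p (x + t • a) : ℝ) : ℂ))
        (Complex.I * ((mdot p a : ℝ) : ℂ)) t := by
      have h4 : HasDerivAt (fun t : ℝ => mdot p (x + t • a)) (mdot p a) t := by
        simp only [mdot_add_right, mdot_smul_right]
        simpa using ((hasDerivAt_id t).mul_const (mdot p a)).const_add (mdot p x)
      exact (HasDerivAt.ofReal_comp h4).const_mul _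
    have h5 := (h3.cexp).mul_const (h p)
    exact h5.congr_deriv (by rw [mulMdot_apply]; ring)

lemma minkFT_comp_smul (h : Mink s → ℂ) {r : ℝ} (hr : 0 < r) (x : Mink s) :
    minkFT (fun p => h (r⁻¹ • p)) x = (r : ℂ) ^ (s + 1) * minkFT h (r • x) := by
  have h1 := Measure.integral_comp_smul (volume : Measure (Mink s))
    (fun p => Complex.exp (Complex.I * (mdot p (r • x) : ℝ)) * h p) r⁻¹
  rw [finrank_euclideanSpace_fin, inv_pow, inv_inv, abs_of_pos (by positivity),
    Complex.real_smul] at h1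
  rw [minkFT, minkFT]
  push_cast at h1
  rw [← h1]
  simp only [mdot_smul_left, mdot_smul_right,
    mul_inv_cancel_left₀ hr.ne']

lemma integral_comp_smul_mul {Y : Type*} [NormedAddCommGroup Y] [NormedSpace ℝ Y]
    (F : Mink s → Y) {r : ℝ} (hr : 0 < r) :
    r ^ (s + 1) • ∫ x, F (r • x) = ∫ x, F x := by
  rw [Measure.integral_comp_smul, finrank_euclideanSpace_fin, abs_of_pos (by positivity),
    smul_smul, mul_inv_cancel₀ (by positivity), one_smul]

/-- Translation contributes a phase, and dilation preserves the L¹ norm of the transform. Hence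
localisation bounds can be uniform in the scale. -/
lemma integral_norm_minkFT_comp (h : Mink s → ℂ) {r : ℝ} (hr : 0 < r) (p₀ : Mink s) :
    ∫ x, ‖minkFT (fun p => h (r⁻¹ • (p + p₀))) x‖ = ∫ x, ‖minkFT h x‖ := by
  rw [← integral_comp_smul_mul (fun x => ‖minkFT h x‖) hr, ← integral_smul]
  congr 1; funext x
  have h1 := minkFT_translate (fun p => h (r⁻¹ • p)) p₀ x
  rw [h1, minkFT_comp_smul h hr, norm_mul, norm_mul, ← mul_neg, ← Complex.ofReal_neg,
    norm_cexp_I_mul, one_mul, norm_pow, Complex.norm_real, Real.norm_of_nonneg hr.le, smul_eq_mul]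

lemma smul_schwartz_apply (k h : 𝓢(Mink s, ℂ)) (p : Mink s) :
    SchwartzMap.smulLeftCLM ℂ k h p = k p * h p := by
  rw [SchwartzMap.smulLeftCLM_apply_apply k.hasTemperateGrowth, smul_eq_mul]

lemma minkFT_mul (k h : 𝓢(Mink s, ℂ)) (x : Mink s) :
    (2 * Real.pi : ℂ) ^ (s + 1) * minkFT (SchwartzMap.smulLeftCLM ℂ k h) x =
      ∫ η, minkFT k η * minkFT h (x - η) := by
  have hc : Continuous fun p : Mink s => Complex.exp (Complex.I * (mdot p x : ℝ)) := by
    have h1 : Continuous fun p : Mink s => mdot p x :=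
      continuous_mdot.comp (continuous_id.prodMk continuous_const)
    exact Complex.continuous_exp.comp (continuous_const.mul (Complex.continuous_ofReal.comp h1))
  have hi : Integrable fun p => Complex.exp (Complex.I * (mdot p x : ℝ)) * h p :=
    h.integrable.bdd_mul (c := 1) hc.aestronglyMeasurable
      (Filter.Eventually.of_forall fun p => (norm_cexp_I_mul _).le)
  have h2 := integral_comp_mul k hi measurable_id
  calc _ = (2 * Real.pi : ℂ) ^ (s + 1) *
        ∫ q, k (id q) * (Complex.exp (Complex.I * (mdot q x : ℝ)) * h q) := by
        rw [minkFT]; congr 2; funext q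
        rw [smul_schwartz_apply, id]; ring
    _ = _ := by
        rw [h2]
        congr 1; funext η
        change _ * _ = _ * ∫ q, _; congr 2; funext q
        rw [← mul_assoc, ← Complex.exp_add, mdot_sub_right, id]
        congr 2; push_cast; ring

end Multipliers

/-! ### Functions of the energy-momentum operators. -/

section SpectralCalculus

variable {s : ℕ} {H : Type*} [NormedAddCommGroup H] [InnerProductSpace ℂ H] [CompleteSpace H]
  (V : SystemRep s H)

/-- The vector `∫ ĥ(ξ) U(ξ, 1)† v dξ`, which is `(2π)ᵈ h(P) v`. -/
noncomputable def spectralVec (h : 𝓢(Mink s, ℂ)) (v : H) : H := ∫ ξ, minkFT h ξ • V.T (-ξ) v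

lemma integrable_spectralVec (h : 𝓢(Mink s, ℂ)) (v : H) :
    Integrable fun ξ => minkFT h ξ • V.T (-ξ) v := by
  refine ((integrable_minkFT h).norm.mul_const ‖v‖).mono' ?_
    (Filter.Eventually.of_forall fun ξ => by rw [norm_smul, V.norm_T_apply])
  exact ((continuous_minkFT h).smul
    ((V.continuous_T_apply v).comp continuous_neg)).aestronglyMeasurable

lemma spectralVec_sub (h k : 𝓢(Mink s, ℂ)) (v : H) :
    spectralVec V (h - k) v = spectralVec V h v - spectralVec V k v := by
  rw [spectralVec, spectralVec, spectralVec, ← integral_sub (integrable_spectralVec V h v)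
    (integrable_spectralVec V k v)]
  simp only [← minkFTCLM_apply, map_sub, _root_.sub_apply, sub_smul]

lemma spectralVec_smul (c : ℂ) (h : 𝓢(Mink s, ℂ)) (v : H) :
    spectralVec V (c • h) v = c • spectralVec V h v := by
  rw [spectralVec, spectralVec, ← integral_smul]
  simp only [← minkFTCLM_apply, map_smul, _root_.smul_apply, smul_smul, smul_eq_mul]

/-- By the convolution theorem (kh)(P) = k(P) h(P), and (2π)ᵈ k(P) is the average of unitaries with
weight the transform of k, so its norm is at most the L¹ norm of that weight. -/
lemma norm_spectralVec_mul_le (k h : 𝓢(Mink s, ℂ)) (v : H) :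
    (2 * Real.pi) ^ (s + 1) * ‖spectralVec V (SchwartzMap.smulLeftCLM ℂ k h) v‖ ≤
      (∫ η, ‖minkFT k η‖) * ‖spectralVec V h v‖ := by
  have h1 : (2 * Real.pi : ℂ) ^ (s + 1) • spectralVec V (SchwartzMap.smulLeftCLM ℂ k h) v =
      ∫ η, minkFT k η • V.T (-η) (spectralVec V h v) := by
    rw [spectralVec, ← integral_smul]
    simp_rw [smul_smul, minkFT_mul]
    rw [integral_convolution_smul (ι := fun η : Mink s => η) continuous_id (integrable_minkFT k)
      (integrable_minkFT h) (G := fun ξ => V.T (-ξ) v)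
      ((V.continuous_T_apply v).comp continuous_neg) (C := ‖v‖) (fun ξ => by simp)]
    congr 1; funext η; congr 1
    rw [spectralVec, ← ContinuousLinearMap.integral_comp_comm _ (integrable_spectralVec V h v)]
    congr 1; funext ξ
    rw [map_smul, V.T_T_apply, neg_add_rev]
  have h2 : ‖(2 * Real.pi : ℂ) ^ (s + 1)‖ = (2 * Real.pi) ^ (s + 1) := by
    rw [norm_pow, norm_mul, Complex.norm_ofNat, Complex.norm_real,
      Real.norm_of_nonneg Real.pi_pos.le]
  rw [← h2, ← norm_smul, h1, ← integral_mul_const]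
  refine (norm_integral_le_integral_norm _).trans (le_of_eq ?_)
  simp only [norm_smul, V.norm_T_apply]

/-- A translation of the vector can be moved to the argument of the transform of h. The derivative
then falls on this smooth function, whatever v is, and produces the multiplier p_μ. -/
lemma hasMomentum_spectralVec (h : 𝓢(Mink s, ℂ)) (v : H) :
    V.HasMomentum (spectralVec V h v)
      fun μ => spectralVec V (mulMdot (EuclideanSpace.single μ 1) h) v := by
  intro μ
  set a : Mink s := EuclideanSpace.single μ 1 with ha
  have e : ∀ t : ℝ, V.T (t • a) (spectralVec V h v) = ∫ ξ, minkFT h (ξ + t • a) • V.T (-ξ) v :=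
    fun t => by
      rw [spectralVec, ← ContinuousLinearMap.integral_comp_comm _ (integrable_spectralVec V h v),
        ← integral_add_right_eq_self _ (t • a)]
      congr 1; funext ξ
      rw [map_smul, V.T_T_apply]
      congr 3; abel
  simp_rw [e]
  set k := mulMdot a h with hk
  obtain ⟨C, hC0, hC⟩ := exists_norm_schwartz_le (minkFTCLM s k)
    (volume : Measure (Mink s)).integrablePower
  set N := (volume : Measure (Mink s)).integrablePower
  have hbound : Integrable fun ξ : Mink s => C * 2 ^ (N : ℝ) * (1 + ‖ξ‖) ^ (-(N : ℝ)) * ‖v‖ :=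
    ((Measure.integrable_pow_neg_integrablePower _).const_mul _).mul_const _
  have hna : ‖a‖ = 1 := by simp [ha]
  have hcont : ∀ (f : 𝓢(Mink s, ℂ)) (t : ℝ),
      Continuous fun ξ => minkFT f (ξ + t • a) • V.T (-ξ) v := fun f t =>
    ((continuous_minkFT f).comp (continuous_id.add continuous_const)).smul
      ((V.continuous_T_apply v).comp continuous_neg)
  have key := hasDerivAt_integral_of_dominated_loc_of_deriv_le (μ := (volume : Measure (Mink s)))
    (F := fun (t : ℝ) ξ => minkFT h (ξ + t • a) • V.T (-ξ) v)
    (F' := fun (t : ℝ) ξ => (Complex.I * minkFT k (ξ + t • a)) • V.T (-ξ) v)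
    (x₀ := 0) (Metric.ball_mem_nhds (0 : ℝ) one_pos)
    (Filter.Eventually.of_forall fun t => (hcont h t).aestronglyMeasurable)
    (by simpa using integrable_spectralVec V h v)
    (by simp_rw [mul_smul]; exact ((hcont k 0).const_smul _).aestronglyMeasurable)
    (Filter.Eventually.of_forall fun ξ t ht => ?_) hbound
    (Filter.Eventually.of_forall fun ξ t _ => (hasDerivAt_minkFT h ξ a t).smul_const _)
  · have h2 := key.2
    simp only [zero_smul, add_zero, mul_smul] at h2
    rw [integral_smul] at h2
    exact h2
  · rw [norm_smul, norm_mul, Complex.norm_I, one_mul, V.norm_T_apply, ← minkFTCLM_apply]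
    refine mul_le_mul_of_nonneg_right ((hC _).trans ?_) (norm_nonneg _)
    rw [mul_assoc]
    refine mul_le_mul_of_nonneg_left ?_ hC0
    -- For |t| < 1 the shift has length at most one; this costs the factor 2ᴺ in the majorant.
    have h1 : (1 + ‖ξ‖) / 2 ≤ 1 + ‖ξ + t • a‖ := by
      have h2 : ‖t • a‖ ≤ 1 := by
        rw [norm_smul, hna, mul_one]
        exact (mem_ball_zero_iff.1 ht).le
      have h3 := norm_sub_le (ξ + t • a) (t • a)
      rw [add_sub_cancel_right] at h3
      have h4 := norm_nonneg (ξ + t • a)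
      linarith
    refine (Real.rpow_le_rpow_of_nonpos (by positivity) h1 (by simp)).trans (le_of_eq ?_)
    rw [Real.div_rpow (by positivity) (by norm_num), Real.rpow_neg (by norm_num : (0 : ℝ) ≤ 2),
      div_inv_eq_mul, mul_comm]

/-- A smooth cutoff around `p`, as a test function. -/
noncomputable def bumpSchwartz {p : Mink s} (b : ContDiffBump p) : 𝓢(Mink s, ℂ) :=
  HasCompactSupport.toSchwartzMap (f := fun x => ((b x : ℝ) : ℂ))
    (b.hasCompactSupport.comp_left Complex.ofReal_zero)
    (Complex.ofRealCLM.contDiff.comp b.contDiff)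

lemma bumpSchwartz_apply {p : Mink s} (b : ContDiffBump p) (x : Mink s) :
    bumpSchwartz b x = (b x : ℝ) := rfl

/-- Away from the joint spectrum, the spectral calculus of a small cutoff vanishes. -/
lemma exists_bump_spectralVec_eq_zero {p₀ : Mink s} (hp : p₀ ∉ V.jointSpectrum) :
    ∃ b : ContDiffBump p₀, ∀ v, spectralVec V (bumpSchwartz b) v = 0 := by
  simp only [SystemRep.jointSpectrum, Set.mem_ofPred_eq, not_forall] at hp
  obtain ⟨ε, hε, hp⟩ := hp
  -- Inner radius 2, so that after rescaling by δ this cutoff is 1 on the support, of radius 2δ, of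
  -- the bump chosen below.
  let b₁ : ContDiffBump (0 : Mink s) := ⟨2, 3, by norm_num, by norm_num⟩
  let κ : Fin (s + 1) → 𝓢(Mink s, ℂ) := fun μ =>
    mulMdot (EuclideanSpace.single μ 1) (bumpSchwartz b₁)
  have hC0 : ∀ μ, 0 ≤ ∫ x, ‖minkFT (κ μ) x‖ := fun μ => integral_nonneg fun _ => norm_nonneg _
  set C := ∑ μ, ∫ x, ‖minkFT (κ μ) x‖ with hC
  have hCμ : ∀ μ, ∫ x, ‖minkFT (κ μ) x‖ ≤ C := fun μ =>
    Finset.single_le_sum (f := fun μ => ∫ x, ‖minkFT (κ μ) x‖) (fun μ _ => hC0 μ)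
      (Finset.mem_univ μ)
  have hCn : 0 ≤ C := Finset.sum_nonneg fun μ _ => hC0 μ
  set c : ℝ := (2 * Real.pi) ^ (s + 1) with hc
  have hcpos : 0 < c := by positivity
  -- Small enough for δC < (2π)ᵈε; the summand 1 excludes a zero denominator.
  set δ : ℝ := c * ε / (C + 1) with hδ
  have hδpos : 0 < δ := by positivity
  have hδC : δ * C < c * ε := by
    rw [hδ, div_mul_eq_mul_div, div_lt_iff₀ (by positivity)]
    have : 0 < c * ε := by positivity
    nlinarith
  let b : ContDiffBump p₀ := ⟨δ, 2 * δ, hδpos, by linarith⟩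
  refine ⟨b, fun v => ?_⟩
  set χ := bumpSchwartz b with hχ
  set w := spectralVec V χ v with hw
  -- If w were nonzero, its normalisation would be an ε-approximate joint eigenvector at p₀,
  -- contrary to the choice of ε.
  by_contra hw0
  have hwpos : 0 < ‖w‖ := norm_pos_iff.2 hw0
  have hmom := hasMomentum_spectralVec V χ v
  have hest : ∀ μ, ‖spectralVec V (mulMdot (EuclideanSpace.single μ 1) χ) v -
      ((mdot p₀ (EuclideanSpace.single μ 1) : ℝ) : ℂ) • w‖ < ε * ‖w‖ := fun μ => by
    set a : Mink s := EuclideanSpace.single μ 1 with ha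
    let e : Mink s ≃L[ℝ] Mink s :=
      ContinuousLinearEquiv.smulLeft (Units.mk0 δ⁻¹ (inv_ne_zero hδpos.ne'))
    let k₀ : 𝓢(Mink s, ℂ) := SchwartzMap.compSubConstCLM ℂ p₀
      (SchwartzMap.compCLMOfContinuousLinearEquiv ℂ e (κ μ))
    have hk₀ : ∀ p, k₀ p = κ μ (δ⁻¹ • (p + -p₀)) := fun p => by
      rw [← sub_eq_add_neg]
      simp only [k₀, SchwartzMap.compSubConstCLM_apply]
      rfl
    -- On the support of χ, (p - p₀)_μ = δ κ_μ((p - p₀)/δ). The gain is the factor δ, while the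
    -- transform of the rescaled κ_μ keeps its L¹ norm.
    have hmul : mulMdot a χ - ((mdot p₀ a : ℝ) : ℂ) • χ =
        (δ : ℂ) • SchwartzMap.smulLeftCLM ℂ k₀ χ := by
      ext p
      rw [_root_.sub_apply, _root_.smul_apply, _root_.smul_apply, mulMdot_apply, smul_schwartz_apply, hk₀,
        mulMdot_apply, mdot_smul_left, ← sub_eq_add_neg, mdot_sub_left, ← ha]
      simp only [smul_eq_mul]
      by_cases hpp : dist p p₀ < 2 * δ
      · have h1 : b₁ (δ⁻¹ • (p - p₀)) = 1 := by
          refine b₁.one_of_mem_closedBall ?_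
          rw [mem_closedBall_zero_iff, norm_smul, norm_inv, Real.norm_of_nonneg hδpos.le,
            ← dist_eq_norm, inv_mul_le_iff₀ hδpos, mul_comm]
          exact hpp.le
        rw [bumpSchwartz_apply b₁, h1]
        have : (δ : ℂ) ≠ 0 := by exact_mod_cast hδpos.ne'
        push_cast
        field_simp
      · have h0 : χ p = 0 := by
          rw [hχ, bumpSchwartz_apply, b.zero_of_le_dist (not_lt.1 hpp), Complex.ofReal_zero]
        rw [h0]; ring
    rw [hw, ← spectralVec_smul, ← spectralVec_sub, hmul, spectralVec_smul, norm_smul,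
      Complex.norm_real, Real.norm_of_nonneg hδpos.le]
    have hn := norm_spectralVec_mul_le V k₀ χ v
    have hk1 : ∫ x, ‖minkFT k₀ x‖ = ∫ x, ‖minkFT (κ μ) x‖ := by
      rw [← integral_norm_minkFT_comp (κ μ) hδpos (-p₀), show (k₀ : Mink s → ℂ) = _ from funext hk₀]
    rw [hk1, ← hw] at hn
    have hn2 : c * ‖spectralVec V (SchwartzMap.smulLeftCLM ℂ k₀ χ) v‖ ≤ C * ‖w‖ :=
      hn.trans (mul_le_mul_of_nonneg_right (hCμ μ) hwpos.le)
    have h3 : c * (δ * ‖spectralVec V (SchwartzMap.smulLeftCLM ℂ k₀ χ) v‖) < c * (ε * ‖w‖) := by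
      nlinarith
    exact lt_of_mul_lt_mul_left h3 hcpos.le
  refine hp ⟨(‖w‖⁻¹ : ℂ) • w, fun μ => (‖w‖⁻¹ : ℂ) •
    spectralVec V (mulMdot (EuclideanSpace.single μ 1) χ) v, ?_, fun μ => ?_, fun μ => ?_⟩
  · rw [norm_smul, norm_inv, Complex.norm_real, norm_norm, inv_mul_cancel₀ hwpos.ne']
  · have := (hmom μ).const_smul (‖w‖⁻¹ : ℂ)
    simp only [map_smul]
    rw [smul_comm]
    exact this
  · rw [smul_comm _ (‖w‖⁻¹ : ℂ) w, ← smul_sub, norm_smul, norm_inv, Complex.norm_real, norm_norm,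
      inv_mul_lt_iff₀ hwpos, mul_comm]
    exact hest μ

end SpectralCalculus

/-! ### Cutoffs in one momentum variable and localisation. -/

section CoordinateMultipliers

variable {s n : ℕ}

lemma continuous_single_mink (j : Fin n) :
    Continuous fun η : Mink s => (Pi.single j η : Fin n → Mink s) :=
  continuous_single (A := fun _ : Fin n => Mink s) j

/-- Multiplication of a test function by `q ↦ h (q j)`. -/
noncomputable def coordMul (j : Fin n) (h : 𝓢(Mink s, ℂ)) (f : 𝓢(Fin n → Mink s, ℂ)) :
    𝓢(Fin n → Mink s, ℂ) :=
  SchwartzMap.smulLeftCLM ℂ (fun q : Fin n → Mink s => h (q j)) f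

lemma coordMul_apply (j : Fin n) (h : 𝓢(Mink s, ℂ)) (f : 𝓢(Fin n → Mink s, ℂ))
    (q : Fin n → Mink s) : coordMul j h f q = h (q j) * f q := by
  have hg : (fun q : Fin n → Mink s => h (q j)).HasTemperateGrowth :=
    h.hasTemperateGrowth.comp
      (ContinuousLinearMap.proj (R := ℝ) (φ := fun _ : Fin n => Mink s) j).hasTemperateGrowth
  rw [coordMul, SchwartzMap.smulLeftCLM_apply_apply hg, smul_eq_mul]

lemma prodFT_coordMul (j : Fin n) (h : 𝓢(Mink s, ℂ)) (f : 𝓢(Fin n → Mink s, ℂ))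
    (ξ : Fin n → Mink s) : (2 * Real.pi : ℂ) ^ (s + 1) * prodFT (coordMul j h f) ξ =
      ∫ η, minkFT h η * prodFT f (ξ - Pi.single j η) := by
  have hi : Integrable fun q : Fin n → Mink s =>
      Complex.exp (Complex.I * ((∑ j, mdot (q j) (ξ j) : ℝ) : ℂ)) * f q :=
    f.integrable.bdd_mul (c := 1)
      (continuous_phase.comp (continuous_id.prodMk continuous_const)).aestronglyMeasurable
      (Filter.Eventually.of_forall fun p => (norm_cexp_I_mul _).le)
  have h2 := integral_comp_mul h hi (measurable_pi_apply j)
  calc _ = (2 * Real.pi : ℂ) ^ (s + 1) * ∫ q : Fin n → Mink s, h (q j) *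
        (Complex.exp (Complex.I * ((∑ j, mdot (q j) (ξ j) : ℝ) : ℂ)) * f q) := by
        rw [prodFT]; congr 2; funext q
        rw [coordMul_apply]; ring
    _ = _ := by
        rw [h2]
        congr 1; funext η
        rw [prodFT]; congr 2; funext q
        have e : ∑ k, mdot (q k) ((ξ - Pi.single j η : Fin n → Mink s) k) =
            ∑ k, mdot (q k) (ξ k) - mdot (q j) η := by
          simp only [Pi.sub_apply, mdot_sub_right, Finset.sum_sub_distrib]
          congr 1
          rw [Finset.sum_eq_single j (fun k _ hk => by rw [Pi.single_eq_of_ne hk, mdot_zero_right])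
            (fun hj => absurd (Finset.mem_univ j) hj), Pi.single_eq_same]
        rw [e, ← mul_assoc, ← Complex.exp_add]
        congr 2; push_cast; ring

variable {G : (Fin n → Mink s) → ℂ} {C : ℝ}

/-- Transfers the multiplier from the test function to G, where it averages translates in the j-th
variable. -/
lemma integral_mul_prodFT_coordMul (hG : Continuous G) (hC : ∀ ξ, ‖G ξ‖ ≤ C) (j : Fin n)
    (h : 𝓢(Mink s, ℂ)) (f : 𝓢(Fin n → Mink s, ℂ)) :
    (2 * Real.pi : ℂ) ^ (s + 1) * ∫ ξ, G ξ * prodFT (coordMul j h f) ξ =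
      ∫ η, minkFT h η * ∫ ξ, prodFT f ξ * G (ξ + Pi.single j η) := by
  have h1 := integral_convolution_smul (E := Fin n → Mink s) (ι := fun η => Pi.single j η)
    (continuous_single_mink j) (integrable_minkFT h) (integrable_prodFT f) hG hC
  simp only [smul_eq_mul] at h1
  rw [← h1, ← integral_const_mul]
  congr 1; funext ξ
  rw [← prodFT_coordMul]; ring

lemma continuous_integral_prodFT_mul (hG : Continuous G) (hC : ∀ ξ, ‖G ξ‖ ≤ C) (j : Fin n)
    (f : 𝓢(Fin n → Mink s, ℂ)) :
    Continuous fun η => ∫ ξ, prodFT f ξ * G (ξ + Pi.single j η) := by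
  have hadd : ∀ η : Mink s, Continuous fun ξ : Fin n → Mink s => G (ξ + Pi.single j η) :=
    fun η => hG.comp (continuous_id.add continuous_const)
  refine continuous_of_dominated (bound := fun ξ => ‖prodFT f ξ‖ * C)
    (fun η => ((continuous_prodFT f).mul (hadd η)).aestronglyMeasurable)
    (fun η => Filter.Eventually.of_forall fun ξ => ?_) ((integrable_prodFT f).norm.mul_const C)
    (Filter.Eventually.of_forall fun ξ => continuous_const.mul (hG.comp
      (continuous_const.add (continuous_single_mink j))))
  rw [norm_mul]
  exact mul_le_mul_of_nonneg_left (hC _) (norm_nonneg _)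

/-- The test function `p ↦ h (r⁻¹ p)`. -/
noncomputable def dilate (h : 𝓢(Mink s, ℂ)) (r : ℝ) (hr : 0 < r) : 𝓢(Mink s, ℂ) :=
  SchwartzMap.compCLMOfContinuousLinearEquiv ℂ
    (ContinuousLinearEquiv.smulLeft (Units.mk0 r⁻¹ (inv_ne_zero hr.ne'))) h

lemma dilate_apply (h : 𝓢(Mink s, ℂ)) {r : ℝ} (hr : 0 < r) (p : Mink s) :
    dilate h r hr p = h (r⁻¹ • p) := rfl

/-- Removal of a cutoff in one variable. -/
lemma integral_mul_prodFT_eq_zero_of_dilate (hG : Continuous G) (hC : ∀ ξ, ‖G ξ‖ ≤ C) (j : Fin n)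
    {h : 𝓢(Mink s, ℂ)} (h0 : h 0 = 1) {f : 𝓢(Fin n → Mink s, ℂ)}
    (hf : ∀ r hr, ∫ ξ, G ξ * prodFT (coordMul j (dilate h r hr) f) ξ = 0) :
    ∫ ξ, G ξ * prodFT f ξ = 0 := by
  set A : Mink s → ℂ := fun η => ∫ ξ, prodFT f ξ * G (ξ + Pi.single j η) with hA
  have hAc : Continuous A := continuous_integral_prodFT_mul hG hC j f
  set K := ∫ ξ, ‖prodFT f ξ‖ * C with hK
  have hAb : ∀ η, ‖A η‖ ≤ K := fun η => by
    refine norm_integral_le_of_norm_le ((integrable_prodFT f).norm.mul_const C)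
      (Filter.Eventually.of_forall fun ξ => ?_)
    rw [norm_mul]
    exact mul_le_mul_of_nonneg_left (hC _) (norm_nonneg _)
  -- The substitution η ↦ rη moves the scale from the cutoff into the argument of A.
  have hz : ∀ r : ℝ, 0 < r → ∫ η, minkFT h η * A (r⁻¹ • η) = 0 := fun r hr => by
    rw [← integral_comp_smul_mul _ hr, Complex.real_smul]
    have h1 := integral_mul_prodFT_coordMul hG hC j (dilate h r hr) f
    rw [hf r hr, mul_zero] at h1
    rw [h1, ← integral_const_mul]
    congr 1; funext η
    have h2 : minkFT (dilate h r hr) η = (r : ℂ) ^ (s + 1) * minkFT h (r • η) :=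
      minkFT_comp_smul h hr η
    rw [h2, inv_smul_smul₀ hr.ne']
    push_cast; ring
  -- As the cutoff widens, A(η/r) tends to A(0), the pairing without a cutoff. By inversion its
  -- coefficient is (2π)ᵈ h(0) ≠ 0.
  have hlim : Filter.Tendsto (fun m : ℕ => ∫ η, minkFT h η * A (((m : ℝ) + 1)⁻¹ • η)) .atTop
      (nhds (∫ η, minkFT h η * A 0)) := by
    refine tendsto_integral_of_dominated_convergence (fun η => ‖minkFT h η‖ * K)
      (fun m => ((continuous_minkFT h).mul (hAc.comp
        (continuous_const_smul _))).aestronglyMeasurable)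
      ((integrable_minkFT h).norm.mul_const K)
      (fun m => Filter.Eventually.of_forall fun η => ?_)
      (Filter.Eventually.of_forall fun η => ?_)
    · rw [norm_mul]
      exact mul_le_mul_of_nonneg_left (hAb _) (norm_nonneg _)
    · have h1 : Filter.Tendsto (fun m : ℕ => ((m : ℝ) + 1)⁻¹ • η) .atTop (nhds ((0 : ℝ) • η)) := by
        have h2 := tendsto_one_div_add_atTop_nhds_zero_nat (𝕜 := ℝ)
        simp only [one_div] at h2
        exact h2.smul_const η
      rw [zero_smul] at h1
      exact ((hAc.tendsto 0).comp h1).const_mul _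
  have hlim0 : ∫ η, minkFT h η * A 0 = 0 := by
    refine tendsto_nhds_unique hlim ?_
    simp_rw [fun m : ℕ => hz ((m : ℝ) + 1) (by positivity)]
    exact tendsto_const_nhds
  have h3 := integral_minkFT h.continuous h.integrable (integrable_minkFT h)
  rw [integral_mul_const, h3, h0, mul_one] at hlim0
  have h4 : A 0 = 0 := (mul_eq_zero.1 hlim0).resolve_left
    (pow_ne_zero _ (mul_ne_zero two_ne_zero (Complex.ofReal_ne_zero.2 Real.pi_ne_zero)))
  rw [← h4, hA]
  congr 1; funext ξ
  rw [Pi.single_zero, add_zero, mul_comm]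

lemma hasCompactSupport_of_coord_le {f : (Fin n → Mink s) → ℂ}
    (h : ∀ j, ∃ R : ℝ, ∀ q, f q ≠ 0 → ‖q j‖ ≤ R) : HasCompactSupport f := by
  choose R hR using h
  refine HasCompactSupport.intro (isCompact_univ_pi fun j =>
    isCompact_closedBall (0 : Mink s) (R j)) fun q hq => ?_
  by_contra hne
  exact hq fun j _ => mem_closedBall_zero_iff.2 (hR j q hne)

/-- A localisation principle: a pairing that annihilates small cutoffs in one variable around each
point of a set annihilates the test functions supported in that set. -/
lemma integral_mul_prodFT_eq_zero_of_local (hG : Continuous G) (hC : ∀ ξ, ‖G ξ‖ ≤ C)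
    {O : Set (Fin n → Mink s)}
    (hO : ∀ q ∈ O, ∃ (j : Fin n) (b : ContDiffBump (q j)), ∀ f,
      ∫ ξ, G ξ * prodFT (coordMul j (bumpSchwartz b) f) ξ = 0)
    (f : 𝓢(Fin n → Mink s, ℂ)) (hf : tsupport f ⊆ O) : ∫ ξ, G ξ * prodFT f ξ = 0 := by
  have hint : ∀ f : 𝓢(Fin n → Mink s, ℂ), Integrable fun ξ => G ξ * prodFT f ξ := fun f =>
    (integrable_prodFT f).bdd_mul (c := C) hG.aestronglyMeasurable (Filter.Eventually.of_forall hC)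
  have hsub : ∀ f g : 𝓢(Fin n → Mink s, ℂ), ∫ ξ, G ξ * prodFT (f - g : 𝓢(_, ℂ)) ξ =
      (∫ ξ, G ξ * prodFT f ξ) - ∫ ξ, G ξ * prodFT g ξ := fun f g => by
    refine Eq.trans ?_ (integral_sub (hint f) (hint g))
    simp only [← prodFTCLM_apply, map_sub, _root_.sub_apply, mul_sub]
  have hcompact : ∀ f : 𝓢(Fin n → Mink s, ℂ), HasCompactSupport f → tsupport f ⊆ O →
      ∫ ξ, G ξ * prodFT f ξ = 0 := by
    intro f hfc hf
    have hO' : ∀ q ∈ O, ∃ N ∈ nhds q, ∃ M : 𝓢(Fin n → Mink s, ℂ) → 𝓢(Fin n → Mink s, ℂ),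
        (∀ f, ∀ x ∈ N, M f x = f x) ∧ (∀ f x, f x = 0 → M f x = 0) ∧
        ∀ f, ∫ ξ, G ξ * prodFT (M f) ξ = 0 := fun q hq => by
      obtain ⟨j, b, hb⟩ := hO q hq
      refine ⟨(fun q' : Fin n → Mink s => q' j) ⁻¹' Metric.ball (q j) b.rIn,
        (Metric.isOpen_ball.preimage (continuous_apply j)).mem_nhds
          (Metric.mem_ball_self b.rIn_pos), coordMul j (bumpSchwartz b), fun f x hx => ?_,
        fun f x hx => by rw [coordMul_apply, hx, mul_zero], hb⟩
      rw [coordMul_apply, bumpSchwartz_apply, b.one_of_mem_closedBall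
        (Metric.ball_subset_closedBall hx), Complex.ofReal_one, one_mul]
    choose! N hN M hM hM0 hMz using hO'
    obtain ⟨t, ht, hcov⟩ := hfc.elim_nhds_subcover N fun q hq => hN q (hf hq)
    -- Instead of a partition of unity, g is replaced by g - M_q g successively. The pairing is
    -- unchanged, g becomes zero on N q, and earlier zeros persist. A finite cover leaves g = 0.
    have key : ∀ t : Finset (Fin n → Mink s), (∀ q ∈ t, q ∈ tsupport f) →
        ∃ g : 𝓢(Fin n → Mink s, ℂ), ∫ ξ, G ξ * prodFT g ξ = ∫ ξ, G ξ * prodFT f ξ ∧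
          ∀ x, (f x = 0 ∨ ∃ q ∈ t, x ∈ N q) → g x = 0 := by
      classical
      intro t
      induction t using Finset.induction_on with
      | empty => exact fun _ => ⟨f, rfl, fun x hx => by simpa using hx⟩
      | insert q t _ ih =>
        intro ht
        obtain ⟨g, hg, hg0⟩ := ih fun p hp => ht p (Finset.mem_insert_of_mem hp)
        refine ⟨g - M q g, ?_, fun x hx => ?_⟩
        · rw [hsub, hMz q (hf (ht q (Finset.mem_insert_self q t))), sub_zero, hg]
        · rw [_root_.sub_apply]
          have hq := hf (ht q (Finset.mem_insert_self q t))
          by_cases hx' : f x = 0 ∨ ∃ p ∈ t, x ∈ N p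
          · rw [hg0 x hx', hM0 q hq g x (hg0 x hx'), sub_zero]
          · push Not at hx'
            obtain ⟨p, hp, hxp⟩ := hx.resolve_left hx'.1
            rcases Finset.mem_insert.1 hp with rfl | hp
            · rw [hM p hq g x hxp, sub_self]
            · exact absurd hxp (hx'.2 p hp)
    obtain ⟨g, hg, hg0⟩ := key t ht
    have hgz : g = 0 := by
      ext x
      refine hg0 x ?_
      by_cases hx : f x = 0
      · exact Or.inl hx
      · obtain ⟨q, hq, hxq⟩ := Set.mem_iUnion₂.1 (hcov (subset_tsupport _ hx))
        exact Or.inr ⟨q, hq, hxq⟩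
    rw [← hg, hgz]
    simp only [← prodFTCLM_apply, map_zero, _root_.zero_apply, mul_zero, integral_zero]
  -- S contains every coordinate in which the support may be unbounded. A dilated cutoff bounds one
  -- of them and is then removed.
  have hstep : ∀ (S : Finset (Fin n)) (f : 𝓢(Fin n → Mink s, ℂ)), tsupport f ⊆ O →
      (∀ j, j ∉ S → ∃ R : ℝ, ∀ q, f q ≠ 0 → ‖q j‖ ≤ R) → ∫ ξ, G ξ * prodFT f ξ = 0 := by
    intro S
    induction S using Finset.induction_on with
    | empty =>
      exact fun f hf hR => hcompact f
        (hasCompactSupport_of_coord_le fun j => hR j (Finset.notMem_empty j)) hf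
    | insert j S _ ih =>
      intro f hf hR
      let b : ContDiffBump (0 : Mink s) := ⟨1, 2, one_pos, one_lt_two⟩
      refine integral_mul_prodFT_eq_zero_of_dilate hG hC j (h := bumpSchwartz b)
        (by rw [bumpSchwartz_apply, b.one_of_mem_closedBall (Metric.mem_closedBall_self zero_le_one),
          Complex.ofReal_one]) fun r hr => ih _ ?_ fun k hk => ?_
      · exact (SchwartzMap.tsupport_smulLeftCLM_subset _ f).trans
          (Set.inter_subset_left.trans hf)
      · by_cases hkj : k = j
        · subst hkj
          refine ⟨r * 2, fun q hq => ?_⟩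
          rw [coordMul_apply, dilate_apply, bumpSchwartz_apply] at hq
          by_contra hlt
          refine hq ?_
          rw [b.zero_of_le_dist, Complex.ofReal_zero, zero_mul]
          rw [dist_zero_right, norm_smul, norm_inv, Real.norm_of_nonneg hr.le,
            le_inv_mul_iff₀ hr]
          exact (not_le.1 hlt).le
        · obtain ⟨R, hR⟩ := hR k (by simp [hkj, hk])
          refine ⟨R, fun q hq => hR q fun h0 => hq ?_⟩
          rw [coordMul_apply, h0, mul_zero]
  exact hstep Finset.univ f hf fun j hj => absurd (Finset.mem_univ j) hj

end CoordinateMultipliers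

/-! ### Vanishing off the joint spectrum. -/

section SpectralVanishing

variable {s : ℕ} {H : Type*} [NormedAddCommGroup H] [InnerProductSpace ℂ H] [CompleteSpace H]
  (V : SystemRep s H) {Ω : State H}

/-- Term by term in the trace, the integral over η is a matrix element of B (2π)ᵈ h(P) C, which is
zero. -/
lemma integral_minkFT_mul_trace_eq_zero {h : 𝓢(Mink s, ℂ)} (hh : ∀ v, spectralVec V h v = 0)
    (B C : H →L[ℂ] H) : ∫ η, minkFT h η * trace (Ω.1 * (B * V.T (-η) * C)) = 0 := by
  set S := CFC.sqrt Ω.1 with hS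
  have hsum := Ω.2.hasSum_norm_sqrt
  -- Exchanging sum and integral needs a countable index set: summability leaves only countably many
  -- basis vectors with √Ω eᵢ ≠ 0.
  have hcount := hsum.summable.countable_support
  set K := Function.support fun i => ‖S (basis H i)‖ ^ 2 with hK
  have : Countable K := hcount.to_subtype
  have htr : ∀ η, minkFT h η * trace (Ω.1 * (B * V.T (-η) * C)) =
      ∑' i : K, minkFT h η * ⟪S (basis H i), B (V.T (-η) (C (S (basis H i))))⟫_ℂ := fun η => by
    have h1 := (Ω.2.hasSum_sqrt (B * V.T (-η) * C)).mul_left (minkFT h η)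
    rw [← h1.tsum_eq]
    refine (tsum_subtype_eq_of_support_subset fun i hi => ?_).symm
    rw [hK, Function.mem_support]
    intro h0
    have h2 : S (basis H i) = 0 := norm_eq_zero.1 (pow_eq_zero_iff two_ne_zero |>.1 h0)
    exact hi (by simp only [← hS, h2, inner_zero_left, mul_zero])
  have hle : ∀ (i : K) η, ‖minkFT h η * ⟪S (basis H i), B (V.T (-η) (C (S (basis H i))))⟫_ℂ‖ ≤
      ‖minkFT h η‖ * (‖B‖ * ‖C‖ * ‖S (basis H i)‖ ^ 2) := fun i η => by
    rw [norm_mul]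
    refine mul_le_mul_of_nonneg_left ?_ (norm_nonneg _)
    calc _ ≤ ‖S (basis H i)‖ * ‖B (V.T (-η) (C (S (basis H i))))‖ := norm_inner_le_norm _ _
      _ ≤ ‖S (basis H i)‖ * (‖B‖ * (‖C‖ * ‖S (basis H i)‖)) := by
        gcongr
        refine (B.le_opNorm _).trans ?_
        rw [V.norm_T_apply]
        gcongr
        exact C.le_opNorm _
      _ = _ := by ring
  have hint : ∀ i : K, Integrable fun η =>
      minkFT h η * ⟪S (basis H i), B (V.T (-η) (C (S (basis H i))))⟫_ℂ := fun i => by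
    refine ((integrable_minkFT h).norm.mul_const
      (‖B‖ * ‖C‖ * ‖S (basis H i)‖ ^ 2)).mono' ?_ (Filter.Eventually.of_forall (hle i))
    exact ((continuous_minkFT h).mul (continuous_const.inner (B.continuous.comp
      ((V.continuous_T_apply _).comp continuous_neg)))).aestronglyMeasurable
  have hsn : Summable fun i : K => ∫ η, ‖minkFT h η *
      ⟪S (basis H i), B (V.T (-η) (C (S (basis H i))))⟫_ℂ‖ := by
    refine Summable.of_nonneg_of_le (fun i => integral_nonneg fun _ => norm_nonneg _)
      (fun i => integral_mono (hint i).norm ((integrable_minkFT h).norm.mul_const _) (hle i)) ?_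
    simp_rw [integral_mul_const]
    exact ((hsum.summable.subtype K).mul_left _).mul_left _
  have h0 : ∀ i : K, ∫ η, minkFT h η *
      ⟪S (basis H i), B (V.T (-η) (C (S (basis H i))))⟫_ℂ = 0 := fun i => by
    have h1 := hh (C (S (basis H i)))
    rw [spectralVec] at h1
    have h2 := ContinuousLinearMap.integral_comp_comm
      (innerSL ℂ (S (basis H i)) ∘L B) (integrable_spectralVec V h (C (S (basis H i))))
    rw [h1, map_zero] at h2
    rw [← h2]
    congr 1; funext η
    rw [map_smul]; rfl
  simp_rw [htr]
  rw [← (hasSum_integral_of_summable_integral_norm hint hsn).tsum_eq]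
  simp [h0]

/-- The Fourier transform of the kernel of a chain vanishes off the spectrum in each variable. -/
lemma integral_trace_chain_eq_zero {n : ℕ} (A : Fin (n + 1) → H →L[ℂ] H)
    (f : 𝓢(Fin n → Mink s, ℂ)) (hf : tsupport f ⊆ {q | ∃ j, q j ∉ V.jointSpectrum}) :
    ∫ ξ, trace (Ω.1 * chain V A ξ) * prodFT f ξ = 0 := by
  obtain ⟨C, hC⟩ := exists_norm_trace_chain_le V (Ω := Ω) A
  have hG := continuous_trace_chain V (Ω := Ω) A
  refine integral_mul_prodFT_eq_zero_of_local hG hC (fun q hq => ?_) f hf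
  obtain ⟨j, hj⟩ := hq
  obtain ⟨b, hb⟩ := exists_bump_spectralVec_eq_zero V hj
  refine ⟨j, b, fun f => ?_⟩
  set h := bumpSchwartz b
  have h1 := integral_mul_prodFT_coordMul hG hC j h f
  have hi : Integrable (Function.uncurry fun (η : Mink s) (ξ : Fin n → Mink s) =>
      minkFT h η * (prodFT f ξ * trace (Ω.1 * chain V A (ξ + Pi.single j η))))
      (volume.prod volume) := by
    have hc : Continuous fun p : Mink s × (Fin n → Mink s) =>
        trace (Ω.1 * chain V A (p.2 + Pi.single j p.1)) :=
      hG.comp (continuous_snd.add ((continuous_single_mink j).comp continuous_fst))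
    refine (((integrable_minkFT h).mul_prod (integrable_prodFT f)).bdd_mul (c := C)
      hc.aestronglyMeasurable (Filter.Eventually.of_forall fun p => hC _)).congr
      (Filter.Eventually.of_forall fun p => ?_)
    simp only [Function.uncurry]; ring
  have h2 : ∫ η, minkFT h η * ∫ ξ, prodFT f ξ * trace (Ω.1 * chain V A (ξ + Pi.single j η)) =
      0 := by
    simp_rw [← integral_const_mul]
    rw [integral_integral_swap hi]
    refine integral_eq_zero_of_ae (Filter.Eventually.of_forall fun ξ => ?_)
    -- At fixed ξ the η-dependence is a single translation, so the η-integral, done first, vanishes.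
    obtain ⟨B, D, hBD⟩ := exists_chain_add_single V A ξ j
    simp only [hBD, Pi.zero_apply, mul_left_comm (minkFT h _)]
    rw [integral_const_mul, integral_minkFT_mul_trace_eq_zero V hb, mul_zero]
  rw [h2] at h1
  exact (mul_eq_zero.1 h1).resolve_left
    (pow_ne_zero _ (mul_ne_zero two_ne_zero (Complex.ofReal_ne_zero.2 Real.pi_ne_zero)))

end SpectralVanishing

end RQFT

open RQFT in
theorem mainTheorem10 {s : ℕ} (hs : 1 ≤ s)
    {HS : Type*} [NormedAddCommGroup HS] [InnerProductSpace ℂ HS] [CompleteSpace HS]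
    [TopologicalSpace.SeparableSpace HS]
    {HR : Type*} [NormedAddCommGroup HR] [InnerProductSpace ℂ HR] [CompleteSpace HR]
    [TopologicalSpace.SeparableSpace HR]
    (V : RQFT.SystemRep s HS) (R : RQFT.RelativisticQRF s HR)
    (Ω : RQFT.State HS) (hΩ : V.IsInvariant Ω)
    (n : ℕ) (ω : Fin (n + 1) → RQFT.State HR) (hω : ∀ i, R.GloballyOriented (ω i))
    (φ : Fin (n + 1) → HS →L[ℂ] HS) :
    ∃ (W : 𝓢'(Fin (n + 1) → RQFT.Mink s, ℂ)) (D : 𝓢'(Fin n → RQFT.Mink s, ℂ)),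
      RQFT.IsFourierTransform (RQFT.vacuumKernel V R Ω ω φ) W ∧
      RQFT.IsFourierTransform (RQFT.differenceKernel V R Ω ω φ) D ∧
      W = ((2 * Real.pi : ℂ) ^ (s + 1)) • RQFT.deltaTotal D ∧
      (V.SpectrumCondition →
        Distribution.IsVanishingOn D {q | ∃ j, q j ∉ V.jointSpectrum}) := by
  set A : Fin (n + 1) → HS →L[ℂ] HS := fun i => relField V R (ω i) (φ i) 0
  have hD : differenceKernel V R Ω ω φ = fun ξ => trace (Ω.1 * chain V A ξ) :=
    funext fun ξ => differenceKernel_eq V hs hΩ R ω φ ξ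
  have hW : vacuumKernel V R Ω ω φ = fun x =>
      trace (Ω.1 * chain V A (fun j => x j.castSucc - x j.succ)) :=
    funext fun x => vacuumKernel_eq V hs hΩ R hω φ x
  obtain ⟨C, hC⟩ := exists_norm_trace_chain_le V (Ω := Ω) A
  have hG := continuous_trace_chain V (Ω := Ω) A
  have hGW : Continuous fun x : Fin (n + 1) → Mink s =>
      trace (Ω.1 * chain V A (fun j => x j.castSucc - x j.succ)) := hG.comp (by fun_prop)
  obtain ⟨W, hWT⟩ := exists_isFourierTransform hGW (fun x => hC _)
  obtain ⟨D, hDT⟩ := exists_isFourierTransform hG hC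
  rw [hD, hW]
  refine ⟨W, D, hWT, hDT, ?_, fun _ f hf => ?_⟩
  · ext f
    rw [(hWT f).2]
    change _ = (2 * Real.pi : ℂ) ^ (s + 1) * deltaTotal D f
    have h1 := integral_mul_prodFT_of_differences hG hC f
    refine h1.trans ?_
    -- The restriction of f to total momentum zero, in partial-sum coordinates.
    let g : 𝓢(Fin n → Mink s, ℂ) := SchwartzMap.compCLMOfAntilipschitz ℂ
      (momenta s n).toContinuousLinearMap.hasTemperateGrowth
      (exists_antilipschitz_momenta s n).choose_spec f
    rw [deltaTotal_apply D f g fun q => rfl, (hDT g).2]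
    rfl
  · rw [(hDT f).2]
    exact integral_trace_chain_eq_zero V A f hf
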